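/- Let $q \ge 1$ be an integer, let $\chi$ be a primitive Dirichlet character modulo $q$ (for $q=1$ this is the trivial character, with $L(s,\chi)=\zeta(s)$), and let $k \ge 1$ and $\ell > 0$ be real numbers. Let $\mu$ denote the Möbius function. For every real $x>0$ the series $$P_{k,\ell,\chi}(x) := \sum_{n=1}^{\infty} \frac{\chi(n)\mu(n)}{n^{k}} \exp\left(-\frac{x}{n^{\ell}}\right) = \lim_{N\to\infty} \sum_{n=1}^{N} \frac{\chi(n)\mu(n)}{n^{k}} \exp\left(-\frac{x}{n^{\ell}}\right)$$ converges, and the following two statements are equivalent: (i) (the generalized Riemann hypothesis for $L(s,\chi)$) every zero $\rho$ of the analytically continued Dirichlet $L$-function $L(s,\chi)$ with $0<\operatorname{Re}(\rho)<1$ satisfies $\operatorname{Re}(\rho)=\tfrac12$; (ii) for every $\varepsilon>0$, $$P_{k,\ell,\chi}(x) = O_{\varepsilon,k,\ell,\chi}\left(x^{-\frac{k}{\ell}+\frac{1}{2\ell}+\varepsilon}\right) \quad \text{as } x \to \infty.$$ -/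

import Mathlib

open Filter Topology Asymptotics

/-- The nontrivial zeros of `L(s, χ)`: its zeros in the open critical strip `0 < Re s < 1`. -/
def IsNontrivialZero {q : ℕ} [NeZero q] (χ : DirichletCharacter ℂ q) (s : ℂ) : Prop :=
  0 < s.re ∧ s.re < 1 ∧ χ.LFunction s = 0

/-- The generalized Riemann hypothesis for `L(s, χ)`: every nontrivial zero lies on the
critical line `Re s = 1 / 2`. -/
def GeneralizedRiemannHypothesis {q : ℕ} [NeZero q] (χ : DirichletCharacter ℂ q) : Prop :=
  ∀ s : ℂ, IsNontrivialZero χ s → s.re = 1 / 2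

/-- The partial sum over `1 ≤ n ≤ N` of `χ(n) μ(n) n ^ (-k) exp (-x / n ^ ℓ)`. -/
noncomputable def rieszPartialSum {q : ℕ} (χ : DirichletCharacter ℂ q) (k ℓ x : ℝ) (N : ℕ) : ℂ :=
  ∑ n ∈ Finset.Icc 1 N,
    χ (n : ZMod q) * (ArithmeticFunction.moebius n : ℂ) / (((n : ℝ) ^ k : ℝ) : ℂ) *
      ((Real.exp (-x / (n : ℝ) ^ ℓ) : ℝ) : ℂ)

/-- The sum over all `n ≥ 1` of `χ(n) μ(n) n ^ (-k) exp (-x / n ^ ℓ)`, as the limit of its partial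
sums. (For `k = 1` the convergence is only conditional, so that `tsum` over `ℕ` is not available.) -/
noncomputable def rieszSum {q : ℕ} (χ : DirichletCharacter ℂ q) (k ℓ x : ℝ) : ℂ :=
  limUnder atTop (rieszPartialSum χ k ℓ x)

/-! Write P for the Riesz sum and Q = -P' (`rieszDeriv`), whose coefficients χ(n)μ(n)n^(-k-ℓ) are
absolutely summable. Then P(x) = 1/L(k,χ) - ∫_0^x Q (`rieszSum_eq`). Convergence at k = 1 needs ∑
χ(n)μ(n)/n = 1/L(1,χ), a statement of prime number theorem strength, obtained from the nonvanishing
of L on Re s = 1 by Newman's contour argument (`tendsto_sum_div_natCast_zero`).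

The link with zeros is the Mellin transform of Q, equal to Γ(s)/L(k+ℓ-ℓs) for 0 < Re s < 1
(`mellin_rieszDeriv`).

From GRH to decay: if L has no zeros in Re w > 1/2, Borel–Carathéodory gives 1/L polynomial growth
there (`exists_norm_invL_le`), which the decay of Γ outweighs. Mellin inversion and a shift of the
line to Re s = 1+a give Q(x) = O(x^(-1-a)) whenever k-ℓa > 1/2. The Mellin formula at s = 1 gives
∫_0^∞ Q = 1/L(k,χ), so P(x) is the tail ∫_x^∞ Q = O(x^(-a)).

From decay to GRH: if P(x) = O(x^(-a)), the Mellin transform of P(x) - e^(-x)/L(k,χ) is holomorphic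
for -1 < Re s < a. It continues Γ(s+1)/L(k-ℓs), so a zero w ≠ 1 of L with k-ℓa < Re w < k+ℓ is
impossible (`eq_one_of_entireL_eq_zero_of_isBigO`). Zeros to the left of 1/2 are excluded by the
symmetry ρ ↦ 1 - conj ρ. -/

/-! ### Cauchy's formula on a square. -/

section RectangleIntegral

open Complex intervalIntegral

lemma integral_two_mul_div_sq_add_sq {R : ℝ} (hR : 0 < R) :
    ∫ x in (-R)..R, (2 * R / (R ^ 2 + x ^ 2) : ℝ) = Real.pi := by
  have h1 : ∀ x ∈ Set.uIcc (-R) R,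
      HasDerivAt (fun x : ℝ => 2 * Real.arctan (x / R)) (2 * R / (R ^ 2 + x ^ 2)) x := by
    intro x _
    have := ((Real.hasDerivAt_arctan (x / R)).comp x ((hasDerivAt_id x).div_const R)).const_mul 2
    refine this.congr_deriv ?_
    have : R ^ 2 + x ^ 2 ≠ 0 := by positivity
    field_simp
  rw [integral_eq_sub_of_hasDerivAt h1]
  · rw [neg_div, div_self hR.ne', Real.arctan_neg, Real.arctan_one]; ring
  · apply Continuous.intervalIntegrable
    exact continuous_const.div (by fun_prop) fun x => by positivity

/-- Integral of `f` over the positively oriented boundary of the square with vertices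
`±R ± R i`. -/
noncomputable def squareIntegral (R : ℝ) (f : ℂ → ℂ) : ℂ :=
  (∫ x in (-R)..R, f (x - R * I)) - (∫ x in (-R)..R, f (x + R * I)) +
    I * (∫ y in (-R)..R, f (R + y * I)) - I * ∫ y in (-R)..R, f (-R + y * I)

lemma squareIntegral_eq_zero {R : ℝ} {f : ℂ → ℂ} (hf : Differentiable ℂ f) :
    squareIntegral R f = 0 := by
  have := integral_boundary_rect_eq_zero_of_differentiableOn f (-R - R * I) (R + R * I)
    hf.differentiableOn
  simpa [squareIntegral, sub_eq_add_neg] using this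

lemma ne_zero_of_re_or_im {z : ℂ} (h : z.re ≠ 0 ∨ z.im ≠ 0) : z ≠ 0 := by
  rintro rfl; simp at h

/-- Opposite edges pair up: each pair of reciprocals combines to 2R/(R² + x²), up to a factor I, so
each pair contributes one arctangent integral π. -/
lemma squareIntegral_inv {R : ℝ} (hR : 0 < R) :
    squareIntegral R (fun s => s⁻¹) = 2 * Real.pi * I := by
  have e := integral_two_mul_div_sq_add_sq hR
  have e' : ∫ x in (-R)..R, (2 * R / (R ^ 2 + x ^ 2) : ℂ) = Real.pi := by
    rw [← e, ← intervalIntegral.integral_ofReal]; push_cast; rfl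
  have c1 : Continuous fun x : ℝ => ((x : ℂ) - R * I)⁻¹ :=
    Continuous.inv₀ (by fun_prop) fun x => ne_zero_of_re_or_im (.inr (by simp [hR.ne']))
  have c2 : Continuous fun x : ℝ => ((x : ℂ) + R * I)⁻¹ :=
    Continuous.inv₀ (by fun_prop) fun x => ne_zero_of_re_or_im (.inr (by simp [hR.ne']))
  have c3 : Continuous fun x : ℝ => ((R : ℂ) + x * I)⁻¹ :=
    Continuous.inv₀ (by fun_prop) fun x => ne_zero_of_re_or_im (.inl (by simp [hR.ne']))
  have c4 : Continuous fun x : ℝ => (-(R : ℂ) + x * I)⁻¹ :=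
    Continuous.inv₀ (by fun_prop) fun x => ne_zero_of_re_or_im (.inl (by simp [hR.ne']))
  have hne : ∀ x : ℝ, (R ^ 2 + x ^ 2 : ℂ) ≠ 0 := fun x => by
    exact_mod_cast (by positivity : R ^ 2 + x ^ 2 ≠ 0)
  have i1 : (∫ x in (-R)..R, ((x : ℂ) - R * I)⁻¹) - (∫ x in (-R)..R, ((x : ℂ) + R * I)⁻¹)
      = I * Real.pi := by
    rw [← integral_sub (c1.intervalIntegrable _ _) (c2.intervalIntegrable _ _), ← e',
      ← intervalIntegral.integral_const_mul]
    refine integral_congr fun x _ => ?_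
    have n1 : ((x : ℂ) - R * I) ≠ 0 := ne_zero_of_re_or_im (.inr (by simp [hR.ne']))
    have n2 : ((x : ℂ) + R * I) ≠ 0 := ne_zero_of_re_or_im (.inr (by simp [hR.ne']))
    have n3 := hne x
    have : (R ^ 2 + x ^ 2 : ℂ) = (x - R * I) * (x + R * I) := by ring_nf; simp
    simp only [this]
    field_simp
    ring
  have i2 : (∫ x in (-R)..R, ((R : ℂ) + x * I)⁻¹) - (∫ x in (-R)..R, (-(R : ℂ) + x * I)⁻¹)
      = Real.pi := by
    rw [← integral_sub (c3.intervalIntegrable _ _) (c4.intervalIntegrable _ _), ← e']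
    refine integral_congr fun x _ => ?_
    have n1 : ((R : ℂ) + x * I) ≠ 0 := ne_zero_of_re_or_im (.inl (by simp [hR.ne']))
    have n2 : (-(R : ℂ) + x * I) ≠ 0 := ne_zero_of_re_or_im (.inl (by simp [hR.ne']))
    have n3 := hne x
    have : (R ^ 2 + x ^ 2 : ℂ) = (R + x * I) * -(-R + x * I) := by ring_nf; simp
    simp only [this]
    field_simp
    ring
  simp only [squareIntegral]
  linear_combination i1 + I * i2

/-- The Cauchy integral formula at the centre of a square. -/
lemma squareIntegral_div {R : ℝ} (hR : 0 < R) {f : ℂ → ℂ} (hf : Differentiable ℂ f) :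
    squareIntegral R (fun s => f s / s) = 2 * Real.pi * I * f 0 := by
  have hg : Differentiable ℂ (dslope f 0) := fun z =>
    ((differentiableOn_dslope univ_mem).mpr hf.differentiableOn).differentiableAt univ_mem
  have key : ∀ s : ℂ, s ≠ 0 → f s / s = dslope f 0 s + f 0 * s⁻¹ := by
    intro s hs
    rw [dslope_of_ne _ hs, slope_def_field]
    field_simp
    ring
  have hgc := hg.continuous
  have c1 : Continuous fun x : ℝ => ((x : ℂ) - R * I)⁻¹ :=
    Continuous.inv₀ (by fun_prop) fun x => ne_zero_of_re_or_im (.inr (by simp [hR.ne']))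
  have c2 : Continuous fun x : ℝ => ((x : ℂ) + R * I)⁻¹ :=
    Continuous.inv₀ (by fun_prop) fun x => ne_zero_of_re_or_im (.inr (by simp [hR.ne']))
  have c3 : Continuous fun x : ℝ => ((R : ℂ) + x * I)⁻¹ :=
    Continuous.inv₀ (by fun_prop) fun x => ne_zero_of_re_or_im (.inl (by simp [hR.ne']))
  have c4 : Continuous fun x : ℝ => (-(R : ℂ) + x * I)⁻¹ :=
    Continuous.inv₀ (by fun_prop) fun x => ne_zero_of_re_or_im (.inl (by simp [hR.ne']))
  have edge : ∀ φ : ℝ → ℂ, Continuous φ → (∀ x, φ x ≠ 0) → Continuous (fun x => (φ x)⁻¹) →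
      ∫ x in (-R)..R, f (φ x) / φ x =
        (∫ x in (-R)..R, dslope f 0 (φ x)) + f 0 * ∫ x in (-R)..R, (φ x)⁻¹ := by
    intro φ hφ h0 hi
    have hgφ : Continuous fun x => dslope f 0 (φ x) := hgc.comp hφ
    rw [← intervalIntegral.integral_const_mul, ← integral_add
      (hgφ.intervalIntegrable _ _) ((hi.const_mul (f 0)).intervalIntegrable _ _)]
    exact integral_congr fun x _ => key _ (h0 x)
  have z := squareIntegral_eq_zero (R := R) hg
  have w := squareIntegral_inv hR
  simp only [squareIntegral] at z w ⊢
  rw [edge _ (by fun_prop) (fun x => ne_zero_of_re_or_im (.inr (by simp [hR.ne']))) c1,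
    edge _ (by fun_prop) (fun x => ne_zero_of_re_or_im (.inr (by simp [hR.ne']))) c2,
    edge _ (by fun_prop) (fun x => ne_zero_of_re_or_im (.inl (by simp [hR.ne']))) c3,
    edge _ (by fun_prop) (fun x => ne_zero_of_re_or_im (.inl (by simp [hR.ne']))) c4]
  linear_combination z + f 0 * w

end RectangleIntegral

/-! ### Power sums by comparison with integrals. -/

section SumBounds

open Finset

lemma sum_Ioc_rpow_le {σ : ℝ} (hσ : 0 < σ) {N M : ℕ} (hN : 0 < N) (hNM : N ≤ M) :
    ∑ n ∈ Ioc N M, (n : ℝ) ^ (-1 - σ) ≤ (N : ℝ) ^ (-σ) / σ := by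
  have hN' : (0 : ℝ) < N := by exact_mod_cast hN
  have hM' : (0 : ℝ) < M := by exact_mod_cast hN.trans_le hNM
  have anti : AntitoneOn (fun x : ℝ => x ^ (-1 - σ)) (Set.Icc (N : ℝ) M) := fun x hx y hy hxy =>
    Real.rpow_le_rpow_of_nonpos (hN'.trans_le hx.1) hxy (by linarith)
  have := anti.sum_le_integral_Ico hNM
  have e : ∑ n ∈ Ioc N M, (n : ℝ) ^ (-1 - σ) =
      ∑ i ∈ Ico N M, ((i + 1 : ℕ) : ℝ) ^ (-1 - σ) := by
    rw [← Finset.sum_image (f := fun n : ℕ => (n : ℝ) ^ (-1 - σ)) (g := fun i => i + 1)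
      (by intro a _ b _ h; simpa using h)]
    congr 1
    ext n; simp only [mem_Ioc, mem_image, mem_Ico]
    constructor
    · intro h; exact ⟨n - 1, by omega, by omega⟩
    · rintro ⟨m, h, rfl⟩; omega
  rw [e]
  refine this.trans ?_
  rw [integral_rpow (Or.inr ⟨by linarith, by
    rw [Set.uIcc_of_le (by exact_mod_cast hNM)]; intro h; exact absurd h.1 (not_le.mpr hN')⟩)]
  have e2 : -1 - σ + 1 = -σ := by ring
  rw [e2, div_neg, ← neg_div, neg_sub]
  gcongr
  have : (0 : ℝ) ≤ (M : ℝ) ^ (-σ) := by positivity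
  linarith

/-- For σ ≤ 1 the summand decreases, and the first term 1 is absorbed by the -1/σ of the integral.
For σ ≥ 1 it increases, and the last term N^(σ-1) is at most N^σ/σ because σ ≤ N, whence the factor
2. -/
lemma sum_Icc_rpow_le {σ : ℝ} (hσ : 0 < σ) {N : ℕ} (hN : 0 < N) (hσN : σ ≤ N) :
    ∑ n ∈ Icc 1 N, (n : ℝ) ^ (σ - 1) ≤ 2 * (N : ℝ) ^ σ / σ := by
  have hN' : (0 : ℝ) < N := by exact_mod_cast hN
  have hN1 : (1 : ℝ) ≤ N := by exact_mod_cast hN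
  have hpos : (0 : ℝ) ≤ (N : ℝ) ^ σ / σ := by positivity
  rcases le_total σ 1 with h1 | h1
  · have anti : AntitoneOn (fun x : ℝ => x ^ (σ - 1)) (Set.Icc ((1 : ℕ) : ℝ) N) :=
      fun x hx y hy hxy => Real.rpow_le_rpow_of_nonpos
        (lt_of_lt_of_le (by norm_num) hx.1) hxy (by linarith)
    have h := anti.sum_le_integral_Ico hN
    rw [integral_rpow (Or.inl (by linarith))] at h
    have e : ∑ n ∈ Icc 1 N, (n : ℝ) ^ (σ - 1) =
        1 + ∑ i ∈ Ico 1 N, ((i + 1 : ℕ) : ℝ) ^ (σ - 1) := by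
      rw [← Finset.sum_image (f := fun n : ℕ => (n : ℝ) ^ (σ - 1)) (g := fun i => i + 1)
        (by intro a _ b _ h; simpa using h)]
      have : Icc 1 N = insert 1 ((Ico 1 N).image fun i => i + 1) := by
        ext n; simp only [mem_Icc, mem_insert, mem_image, mem_Ico]
        constructor
        · intro h
          by_cases h1 : n = 1
          · exact Or.inl h1
          · exact Or.inr ⟨n - 1, by omega, by omega⟩
        · rintro (rfl | ⟨m, h, rfl⟩) <;> omega
      rw [this, Finset.sum_insert (by simp)]
      simp
    rw [e]
    have e2 : σ - 1 + 1 = σ := by ring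
    rw [e2] at h
    simp only [Nat.cast_one, Real.one_rpow, sub_div] at h
    have : 1 ≤ 1 / σ := by rw [le_div_iff₀ hσ]; linarith
    rw [mul_div_assoc]
    linarith
  · have mono : MonotoneOn (fun x : ℝ => x ^ (σ - 1)) (Set.Icc ((1 : ℕ) : ℝ) N) :=
      fun x hx y hy hxy => Real.rpow_le_rpow
        (le_trans (by norm_num) hx.1) hxy (by linarith)
    have h := mono.sum_le_integral_Ico hN
    rw [integral_rpow (Or.inl (by linarith))] at h
    have e : ∑ n ∈ Icc 1 N, (n : ℝ) ^ (σ - 1) =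
        ∑ i ∈ Ico 1 N, (i : ℝ) ^ (σ - 1) + (N : ℝ) ^ (σ - 1) := by
      rw [← Finset.Ico_insert_right hN, Finset.sum_insert (by simp), add_comm]
    rw [e]
    have e2 : σ - 1 + 1 = σ := by ring
    rw [e2] at h
    simp only [Nat.cast_one, Real.one_rpow, sub_div] at h
    have h3 : (N : ℝ) ^ (σ - 1) ≤ (N : ℝ) ^ σ / σ := by
      rw [Real.rpow_sub_one hN'.ne']
      gcongr
    have : 0 ≤ 1 / σ := by positivity
    rw [mul_div_assoc]
    linarith

end SumBounds

/-! ### Newman's Tauberian theorem for Dirichlet series with bounded coefficients. -/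

section Tauberian

open Complex intervalIntegral

/-- The factor `(1 + s² / R²) / s` in Newman's contour integral is small where `Re s` is. -/
lemma norm_newmanKernel_horizontal {R x y : ℝ} (hR : 0 < R) (hx : |x| ≤ R) (hy : |y| = R) :
    ‖(1 + (x + y * I : ℂ) ^ 2 / R ^ 2) / (x + y * I)‖ ≤ 3 * |x| / R ^ 2 := by
  have hR' : (R : ℂ) ≠ 0 := by exact_mod_cast hR.ne'
  have hy2 : (y : ℂ) ^ 2 = (R : ℂ) ^ 2 := by
    have : y ^ 2 = R ^ 2 := by rw [← hy, sq_abs]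
    exact_mod_cast this
  have e : (1 + (x + y * I : ℂ) ^ 2 / R ^ 2) = x * (x + 2 * y * I) / R ^ 2 := by
    field_simp
    linear_combination (-1 : ℂ) * hy2 + (y : ℂ) ^ 2 * I_sq
  have h1 : R ≤ ‖(x + y * I : ℂ)‖ := by
    have := abs_im_le_norm (x + y * I : ℂ)
    simp only [add_im, ofReal_im, mul_im, ofReal_re, I_im, mul_one, I_re, mul_zero, add_zero,
      zero_add] at this
    linarith
  have h2 : ‖(x + 2 * y * I : ℂ)‖ ≤ 3 * R := by
    refine (norm_add_le _ _).trans ?_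
    simp only [norm_mul, norm_real, Real.norm_eq_abs, norm_I, norm_ofNat]
    linarith
  rw [e, norm_div, norm_div, norm_mul, norm_real, Real.norm_eq_abs, norm_pow, norm_real,
    Real.norm_of_nonneg hR.le, div_div]
  calc |x| * ‖(x + 2 * y * I : ℂ)‖ / (R ^ 2 * ‖(x + y * I : ℂ)‖)
      ≤ |x| * (3 * R) / (R ^ 2 * R) := by gcongr
    _ = 3 * |x| / R ^ 2 := by field_simp

lemma norm_newmanKernel_vertical {R x y : ℝ} (hR : 0 < R) (hx : |x| = R) (hy : |y| ≤ R) :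
    ‖(1 + (x + y * I : ℂ) ^ 2 / R ^ 2) / (x + y * I)‖ ≤ 3 * |x| / R ^ 2 := by
  have h1 : R ≤ ‖(x + y * I : ℂ)‖ := by
    have := abs_re_le_norm (x + y * I : ℂ)
    simp only [add_re, ofReal_re, mul_re, I_re, mul_zero, ofReal_im, I_im, mul_one, sub_self,
      add_zero] at this
    linarith
  have h2 : ‖(x + y * I : ℂ)‖ ≤ 2 * R := by
    refine (norm_add_le _ _).trans ?_
    simp only [norm_mul, norm_real, Real.norm_eq_abs, norm_I]
    linarith
  have h0 : (x + y * I : ℂ) ≠ 0 := norm_pos_iff.mp (hR.trans_le h1)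
  have e : (1 + (x + y * I : ℂ) ^ 2 / R ^ 2) / (x + y * I) =
      1 / (x + y * I) + (x + y * I) / R ^ 2 := by
    field_simp
  rw [e]
  refine (norm_add_le _ _).trans ?_
  rw [norm_div, norm_div, norm_one, norm_pow, norm_real, Real.norm_of_nonneg hR.le, hx]
  calc 1 / ‖(x + y * I : ℂ)‖ + ‖(x + y * I : ℂ)‖ / R ^ 2 ≤ 1 / R + 2 * R / R ^ 2 := by gcongr
    _ = 3 * R / R ^ 2 := by field_simp; norm_num

/-- The Dirichlet polynomial `N ^ s * ∑ n ≤ N, a n / n ^ (1 + s)`. -/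
noncomputable def scaledPartialSum (a : ℕ → ℂ) (N : ℕ) (s : ℂ) : ℂ :=
  ∑ n ∈ Finset.Icc 1 N, a n / n * exp (s * Real.log (N / n))

lemma differentiable_scaledPartialSum (a : ℕ → ℂ) (N : ℕ) :
    Differentiable ℂ (scaledPartialSum a N) := by
  unfold scaledPartialSum
  fun_prop

lemma norm_scaledPartialSum_term_le {a : ℕ → ℂ} {C : ℝ} (ha : ∀ n, ‖a n‖ ≤ C) {N n : ℕ}
    (hN : 0 < N) (hn : 0 < n) (s : ℂ) :
    ‖a n / n * exp (s * Real.log (N / n))‖ ≤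
      C * ((N : ℝ) ^ s.re * (n : ℝ) ^ (-1 - s.re)) := by
  have hN' : (0 : ℝ) < N := by exact_mod_cast hN
  have hn' : (0 : ℝ) < n := by exact_mod_cast hn
  rw [norm_mul, norm_div, norm_natCast, norm_exp, re_mul_ofReal, mul_comm s.re,
    ← Real.rpow_def_of_pos (by positivity), Real.div_rpow hN'.le hn'.le, Real.rpow_sub hn',
    Real.rpow_neg_one]
  calc ‖a n‖ / n * ((N : ℝ) ^ s.re / (n : ℝ) ^ s.re)
      ≤ C / n * ((N : ℝ) ^ s.re / (n : ℝ) ^ s.re) := by gcongr; exact ha n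
    _ = _ := by field_simp

/-- Partial sums on the left half-plane and, in the next lemma, tails on the right are O(C/|Re s|)
uniformly in N. This is exactly the singularity that the factor |Re s| in the kernel bounds cancels.
-/
lemma norm_scaledPartialSum_le {a : ℕ → ℂ} {C : ℝ} (ha : ∀ n, ‖a n‖ ≤ C) {N : ℕ} (hN : 0 < N)
    {s : ℂ} (hs : s.re < 0) (hsN : -s.re ≤ N) :
    ‖scaledPartialSum a N s‖ ≤ 2 * C / -s.re := by
  have hC : 0 ≤ C := (norm_nonneg _).trans (ha 0)
  have hN' : (0 : ℝ) < N := by exact_mod_cast hN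
  have hσ : 0 < -s.re := by linarith
  calc ‖scaledPartialSum a N s‖
      ≤ ∑ n ∈ Finset.Icc 1 N, C * ((N : ℝ) ^ s.re * (n : ℝ) ^ (-s.re - 1)) := by
        refine (norm_sum_le _ _).trans (Finset.sum_le_sum fun n hn => ?_)
        have := norm_scaledPartialSum_term_le ha hN (Finset.mem_Icc.mp hn).1 s
        rwa [show -1 - s.re = -s.re - 1 by ring] at this
    _ = C * (N : ℝ) ^ s.re * ∑ n ∈ Finset.Icc 1 N, (n : ℝ) ^ (-s.re - 1) := by
        rw [Finset.mul_sum]; simp only [mul_assoc]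
    _ ≤ C * (N : ℝ) ^ s.re * (2 * (N : ℝ) ^ (-s.re) / -s.re) := by
        gcongr; exact sum_Icc_rpow_le hσ hN hsN
    _ = 2 * C / -s.re * ((N : ℝ) ^ s.re * (N : ℝ) ^ (-s.re)) := by ring
    _ = 2 * C / -s.re := by rw [← Real.rpow_add hN']; simp

lemma norm_exp_mul_LSeries_sub_scaledPartialSum_le {a : ℕ → ℂ} {C : ℝ} (ha : ∀ n, ‖a n‖ ≤ C)
    {N : ℕ} (hN : 0 < N) {s : ℂ} (hs : 0 < s.re) :
    ‖exp (s * Real.log N) * LSeries a (1 + s) - scaledPartialSum a N s‖ ≤ C / s.re := by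
  have hC : 0 ≤ C := (norm_nonneg _).trans (ha 0)
  have hN' : (0 : ℝ) < N := by exact_mod_cast hN
  have hsum : LSeriesSummable a (1 + s) :=
    LSeriesSummable_of_bounded_of_one_lt_re (fun n _ => ha n) (by simpa using hs)
  have term_eq : ∀ n : ℕ, 0 < n → exp (s * Real.log N) * LSeries.term a (1 + s) n =
      a n / n * exp (s * Real.log (N / n)) := by
    intro n hn
    have hn' : (n : ℝ) ≠ 0 := by exact_mod_cast hn.ne'
    have hn'' : (n : ℂ) ≠ 0 := by exact_mod_cast hn.ne'
    rw [LSeries.term_of_ne_zero hn.ne', Real.log_div hN'.ne' hn', ofReal_sub, mul_sub, exp_sub,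
      cpow_add _ _ hn'', cpow_one, cpow_def_of_ne_zero hn'' s, ← natCast_log (n := n),
      mul_comm s (Real.log n : ℂ)]
    field_simp
  have lim : Tendsto (fun M : ℕ => ‖∑ n ∈ Finset.range (M + 1),
      exp (s * Real.log N) * LSeries.term a (1 + s) n - scaledPartialSum a N s‖) atTop
      (𝓝 ‖exp (s * Real.log N) * LSeries a (1 + s) - scaledPartialSum a N s‖) :=
    ((((hsum.hasSum.mul_left _).tendsto_sum_nat).comp (tendsto_add_atTop_nat 1)).sub_const _).norm
  refine le_of_tendsto lim ((eventually_ge_atTop N).mono fun M hM => ?_)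
  have split : ∑ n ∈ Finset.range (M + 1), exp (s * Real.log N) * LSeries.term a (1 + s) n -
      scaledPartialSum a N s = ∑ n ∈ Finset.Ioc N M, a n / n * exp (s * Real.log (N / n)) := by
    have h1 : Finset.range (M + 1) = insert 0 (Finset.Icc 1 N ∪ Finset.Ioc N M) := by
      ext n; simp only [Finset.mem_range, Finset.mem_insert, Finset.mem_union, Finset.mem_Icc,
        Finset.mem_Ioc]; omega
    have h2 : Disjoint (Finset.Icc 1 N) (Finset.Ioc N M) := by
      rw [Finset.disjoint_left]; intro n; simp only [Finset.mem_Icc, Finset.mem_Ioc]; omega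
    rw [h1, Finset.sum_insert (by simp), Finset.sum_union h2, LSeries.term_zero, mul_zero, zero_add,
      Finset.sum_congr rfl fun n hn => term_eq n (Finset.mem_Icc.mp hn).1,
      Finset.sum_congr rfl fun n hn => term_eq n (hN.trans (Finset.mem_Ioc.mp hn).1)]
    simp [scaledPartialSum]
  rw [split]
  calc ‖∑ n ∈ Finset.Ioc N M, a n / n * exp (s * Real.log (N / n))‖
      ≤ ∑ n ∈ Finset.Ioc N M, C * ((N : ℝ) ^ s.re * (n : ℝ) ^ (-1 - s.re)) := by
        refine (norm_sum_le _ _).trans (Finset.sum_le_sum fun n hn => ?_)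
        exact norm_scaledPartialSum_term_le ha hN (hN.trans (Finset.mem_Ioc.mp hn).1) s
    _ = C * (N : ℝ) ^ s.re * ∑ n ∈ Finset.Ioc N M, (n : ℝ) ^ (-1 - s.re) := by
        rw [Finset.mul_sum]; simp only [mul_assoc]
    _ ≤ C * (N : ℝ) ^ s.re * ((N : ℝ) ^ (-s.re) / s.re) := by
        gcongr; exact sum_Ioc_rpow_le hs hN hM
    _ = C / s.re * ((N : ℝ) ^ s.re * (N : ℝ) ^ (-s.re)) := by ring
    _ = C / s.re := by rw [← Real.rpow_add hN']; simp

/-- Riemann–Lebesgue for the integral over the segment `[-iR, iR]` in Newman's argument. -/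
lemma tendsto_integral_mul_exp_log {R : ℝ} (hR : -R ≤ R) (g : ℝ → ℂ) :
    Tendsto (fun N : ℕ => ∫ y in (-R)..R, g y * exp (y * I * Real.log N)) atTop (𝓝 0) := by
  -- No integrability of `g` is needed: for a non-integrable function these integrals are zero by
  -- convention.
  have h := Real.tendsto_integral_exp_smul_cocompact
    ((Set.Ioc (-R) R).indicator fun y => g y)
  have hw : Tendsto (fun N : ℕ => -(Real.log N / (2 * Real.pi))) atTop (cocompact ℝ) :=
    (tendsto_neg_atTop_atBot.comp ((Real.tendsto_log_atTop.comp
      tendsto_natCast_atTop_atTop).atTop_div_const (by positivity))).mono_right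
        atBot_le_cocompact
  refine (h.comp hw).congr fun N => ?_
  simp only [Function.comp]
  rw [integral_of_le hR, ← MeasureTheory.integral_indicator measurableSet_Ioc]
  congr 1
  ext y
  by_cases hy : y ∈ Set.Ioc (-R) R
  · rw [Set.indicator_of_mem hy, Set.indicator_of_mem hy, Circle.smul_def, Real.fourierChar_apply,
      smul_eq_mul, mul_comm]
    congr 2
    push_cast
    field_simp
  · rw [Set.indicator_of_notMem hy, Set.indicator_of_notMem hy, smul_zero]


/-- The partial sum is V(0), which Cauchy's formula expresses as an integral of V times Newman's
kernel over the square. On the left half V itself is small enough. On the right half V is compared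
with the full series N^s · s h(s); its contribution T is holomorphic there and is moved back to the
imaginary axis, where it becomes the oscillating integral. The edges contribute 6 + 6 + 12 on the
left and 3 + 3 + 6 on the right, hence 36. -/
lemma two_pi_mul_norm_sum_div_le {a : ℕ → ℂ} {C : ℝ} (ha : ∀ n, ‖a n‖ ≤ C) {h : ℂ → ℂ}
    (hc : ContinuousOn h {s | 0 ≤ s.re}) (hd : DifferentiableOn ℂ h {s | 0 < s.re})
    (hL : ∀ s : ℂ, 0 < s.re → LSeries a (1 + s) = s * h s) {R : ℝ} (hR : 0 < R) {N : ℕ}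
    (hRN : R ≤ N) :
    2 * Real.pi * ‖∑ n ∈ Finset.Icc 1 N, a n / n‖ ≤ 36 * C / R +
      ‖∫ y in (-R)..R, h (y * I) * (1 + (y * I) ^ 2 / R ^ 2) * exp (y * I * Real.log N)‖ := by
  have hN : 0 < N := by exact_mod_cast hR.trans_le hRN
  have hC : 0 ≤ C := (norm_nonneg _).trans (ha 0)
  have hR0 : (R : ℂ) ≠ 0 := by exact_mod_cast hR.ne'
  set V := scaledPartialSum a N with hV
  have hVd : Differentiable ℂ V := differentiable_scaledPartialSum a N
  have hVc : Continuous V := hVd.continuous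
  set U : ℂ → ℂ := fun s => V s * (1 + s ^ 2 / R ^ 2) / s with hU
  set T : ℂ → ℂ := fun s => h s * (1 + s ^ 2 / R ^ 2) * exp (s * Real.log N) with hT
  have hV0 : V 0 = ∑ n ∈ Finset.Icc 1 N, a n / n := by simp [hV, scaledPartialSum]
  have cauchyU : squareIntegral R U = 2 * Real.pi * I * V 0 := by
    have := squareIntegral_div hR (f := fun s => V s * (1 + s ^ 2 / R ^ 2)) (by fun_prop)
    simpa [hU] using this
  have hTc : ContinuousOn T {s | 0 ≤ s.re} := by
    simp only [hT]
    exact (hc.mul (by fun_prop)).mul (by fun_prop)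
  have hTd : DifferentiableOn ℂ T {s | 0 < s.re} := by
    simp only [hT]
    exact (hd.mul (by fun_prop)).mul (by fun_prop)
  have cauchyT : (∫ x in (0 : ℝ)..R, T (x - R * I)) - (∫ x in (0 : ℝ)..R, T (x + R * I)) +
      I * (∫ y in (-R)..R, T (R + y * I)) - I * ∫ y in (-R)..R, T (y * I) = 0 := by
    have := integral_boundary_rect_eq_zero_of_continuousOn_of_differentiableOn T
      (-(R * I)) (R + R * I)
      (hTc.mono fun s hs => by
        have := hs.1
        simp only [neg_re, mul_re, ofReal_re, I_re, mul_zero, ofReal_im, I_im, mul_one, sub_self,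
          neg_zero, add_re, add_zero, Set.mem_preimage, Set.uIcc_of_le hR.le] at this
        exact this.1)
      (hTd.mono fun s hs => by
        have := hs.1
        simp only [neg_re, mul_re, ofReal_re, I_re, mul_zero, ofReal_im, I_im, mul_one, sub_self,
          neg_zero, add_re, add_zero, Set.mem_preimage, min_eq_left hR.le] at this
        exact this.1)
    simpa [sub_eq_add_neg] using this
  -- pointwise bounds on the two halves of the square
  have boundL : ∀ x y : ℝ, x ≤ 0 → -x ≤ R →
      ‖(1 + (x + y * I : ℂ) ^ 2 / R ^ 2) / (x + y * I)‖ ≤ 3 * |x| / R ^ 2 →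
      ‖U (x + y * I)‖ ≤ 6 * C / R ^ 2 := by
    intro x y hx0 hx hK
    simp only [hU, mul_div_assoc (V _)]
    rw [norm_mul]
    rcases hx0.lt_or_eq with hx0 | rfl
    · have hs : (x + y * I : ℂ).re = x := by simp
      have := norm_scaledPartialSum_le ha hN (s := x + y * I) (by rw [hs]; exact hx0)
        (by rw [hs]; linarith)
      rw [hs] at this
      have hx0' : 0 < -x := by linarith
      calc _ ≤ 2 * C / -x * (3 * |x| / R ^ 2) := by gcongr
        _ = 6 * C / R ^ 2 := by rw [abs_of_neg hx0, div_mul_div_comm]; field_simp [hx0.ne]; ring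
    -- At x = 0 the bound on V is void, but the assumed kernel bound forces the kernel to vanish.
    · have : ‖(1 + ((0 : ℝ) + y * I : ℂ) ^ 2 / R ^ 2) / ((0 : ℝ) + y * I)‖ = 0 :=
        le_antisymm (by simpa using hK) (norm_nonneg _)
      rw [this, mul_zero]
      positivity
  have boundR : ∀ x y : ℝ, 0 < x →
      ‖(1 + (x + y * I : ℂ) ^ 2 / R ^ 2) / (x + y * I)‖ ≤ 3 * |x| / R ^ 2 →
      ‖U (x + y * I) - T (x + y * I)‖ ≤ 3 * C / R ^ 2 := by
    intro x y hx0 hK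
    have hs : (x + y * I : ℂ).re = x := by simp
    have hne : (x + y * I : ℂ) ≠ 0 := ne_zero_of_re_or_im (.inl (by simp [hx0.ne']))
    have e : U (x + y * I) - T (x + y * I) =
        -((exp ((x + y * I) * Real.log N) * LSeries a (1 + (x + y * I)) - V (x + y * I)) *
          ((1 + (x + y * I : ℂ) ^ 2 / R ^ 2) / (x + y * I))) := by
      rw [hL _ (by rw [hs]; exact hx0)]
      simp only [hU, hT]
      field_simp
      ring
    have := norm_exp_mul_LSeries_sub_scaledPartialSum_le ha hN (s := x + y * I)
      (by rw [hs]; exact hx0)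
    rw [hs] at this
    rw [e, norm_neg, norm_mul]
    calc _ ≤ C / x * (3 * |x| / R ^ 2) := by gcongr
      _ = 3 * C / R ^ 2 := by rw [abs_of_pos hx0]; field_simp
  -- continuity on the edges
  have hUc : ∀ φ : ℝ → ℂ, Continuous φ → (∀ x, φ x ≠ 0) → Continuous fun x => U (φ x) := by
    intro φ hφ h0
    simp only [hU]
    exact ((hVc.comp hφ).mul (by fun_prop)).div hφ h0
  have cb : Continuous fun x : ℝ => U (x - R * I) :=
    hUc _ (by fun_prop) fun x => ne_zero_of_re_or_im (.inr (by simp [hR.ne']))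
  have ct : Continuous fun x : ℝ => U (x + R * I) :=
    hUc _ (by fun_prop) fun x => ne_zero_of_re_or_im (.inr (by simp [hR.ne']))
  have cr : Continuous fun x : ℝ => U (R + x * I) :=
    hUc _ (by fun_prop) fun x => ne_zero_of_re_or_im (.inl (by simp [hR.ne']))
  have hTi : ∀ (φ : ℝ → ℂ) (u v : ℝ), Continuous φ → (∀ x ∈ Set.uIcc u v, 0 ≤ (φ x).re) →
      IntervalIntegrable (fun x => T (φ x)) MeasureTheory.volume u v := by
    intro φ u v hφ h0
    exact (hTc.comp hφ.continuousOn h0).intervalIntegrable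
  have tb := hTi (fun x => x - R * I) 0 R (by fun_prop) (by
    intro x hx; rw [Set.uIcc_of_le hR.le] at hx; simpa using hx.1)
  have tt := hTi (fun x => x + R * I) 0 R (by fun_prop) (by
    intro x hx; rw [Set.uIcc_of_le hR.le] at hx; simpa using hx.1)
  have tr := hTi (fun x => R + x * I) (-R) R (by fun_prop) (by intro x hx; simpa using hR.le)
  have id1 : 2 * Real.pi * I * V 0 =
      ((∫ x in (-R)..0, U (x - R * I)) - (∫ x in (-R)..0, U (x + R * I)) -
        I * ∫ y in (-R)..R, U (-R + y * I)) +
      ((∫ x in (0 : ℝ)..R, (U (x - R * I) - T (x - R * I))) -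
        (∫ x in (0 : ℝ)..R, (U (x + R * I) - T (x + R * I))) +
        I * ∫ y in (-R)..R, (U (R + y * I) - T (R + y * I))) +
      I * ∫ y in (-R)..R, T (y * I) := by
    rw [integral_sub (cb.intervalIntegrable _ _) tb, integral_sub (ct.intervalIntegrable _ _) tt,
      integral_sub (cr.intervalIntegrable _ _) tr]
    have s1 := integral_add_adjacent_intervals (cb.intervalIntegrable (-R) 0)
      (cb.intervalIntegrable (μ := MeasureTheory.volume) 0 R)
    have s2 := integral_add_adjacent_intervals (ct.intervalIntegrable (-R) 0)
      (ct.intervalIntegrable (μ := MeasureTheory.volume) 0 R)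
    simp only [squareIntegral] at cauchyU
    linear_combination s2 - s1 + cauchyT - cauchyU
  have e1 : ‖∫ x in (-R)..0, U (x - R * I)‖ ≤ 6 * C / R := by
    have := norm_integral_le_of_norm_le_const (a := -R) (b := 0) (C := 6 * C / R ^ 2)
      (f := fun x : ℝ => U (x - R * I)) fun x hx => by
        rw [Set.uIoc_of_le (by linarith)] at hx
        have := boundL x (-R) hx.2 (by linarith [hx.1]) (norm_newmanKernel_horizontal hR
          (abs_le.mpr ⟨by linarith [hx.1], by linarith [hx.2]⟩) (by simp [abs_of_pos hR]))
        simpa [sub_eq_add_neg] using this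
    refine this.trans_eq ?_
    rw [zero_sub, neg_neg, abs_of_pos hR]; field_simp
  have e2 : ‖∫ x in (-R)..0, U (x + R * I)‖ ≤ 6 * C / R := by
    have := norm_integral_le_of_norm_le_const (a := -R) (b := 0) (C := 6 * C / R ^ 2)
      (f := fun x : ℝ => U (x + R * I)) fun x hx => by
        rw [Set.uIoc_of_le (by linarith)] at hx
        exact boundL x R hx.2 (by linarith [hx.1]) (norm_newmanKernel_horizontal hR
          (abs_le.mpr ⟨by linarith [hx.1], by linarith [hx.2]⟩) (abs_of_pos hR))
    refine this.trans_eq ?_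
    rw [zero_sub, neg_neg, abs_of_pos hR]; field_simp
  have e3 : ‖∫ y in (-R)..R, U (-R + y * I)‖ ≤ 12 * C / R := by
    have := norm_integral_le_of_norm_le_const (a := -R) (b := R) (C := 6 * C / R ^ 2)
      (f := fun y : ℝ => U (-R + y * I)) fun y hy => by
        rw [Set.uIoc_of_le (by linarith)] at hy
        have := boundL (-R) y (by linarith) (by linarith) (norm_newmanKernel_vertical hR
          (by simp [abs_of_pos hR]) (abs_le.mpr ⟨by linarith [hy.1], by linarith [hy.2]⟩))
        simpa using this
    refine this.trans_eq ?_
    rw [sub_neg_eq_add, abs_of_pos (by linarith)]; field_simp; ring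
  have e4 : ‖∫ x in (0 : ℝ)..R, (U (x - R * I) - T (x - R * I))‖ ≤ 3 * C / R := by
    have := norm_integral_le_of_norm_le_const (a := 0) (b := R) (C := 3 * C / R ^ 2)
      (f := fun x : ℝ => U (x - R * I) - T (x - R * I)) fun x hx => by
        rw [Set.uIoc_of_le hR.le] at hx
        have := boundR x (-R) hx.1 (norm_newmanKernel_horizontal hR
          (abs_le.mpr ⟨by linarith [hx.1], by linarith [hx.2]⟩) (by simp [abs_of_pos hR]))
        simpa [sub_eq_add_neg] using this
    refine this.trans_eq ?_
    rw [sub_zero, abs_of_pos hR]; field_simp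
  have e5 : ‖∫ x in (0 : ℝ)..R, (U (x + R * I) - T (x + R * I))‖ ≤ 3 * C / R := by
    have := norm_integral_le_of_norm_le_const (a := 0) (b := R) (C := 3 * C / R ^ 2)
      (f := fun x : ℝ => U (x + R * I) - T (x + R * I)) fun x hx => by
        rw [Set.uIoc_of_le hR.le] at hx
        exact boundR x R hx.1 (norm_newmanKernel_horizontal hR
          (abs_le.mpr ⟨by linarith [hx.1], by linarith [hx.2]⟩) (abs_of_pos hR))
    refine this.trans_eq ?_
    rw [sub_zero, abs_of_pos hR]; field_simp
  have e6 : ‖∫ y in (-R)..R, (U (R + y * I) - T (R + y * I))‖ ≤ 6 * C / R := by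
    have := norm_integral_le_of_norm_le_const (a := -R) (b := R) (C := 3 * C / R ^ 2)
      (f := fun y : ℝ => U (R + y * I) - T (R + y * I)) fun y hy => by
        rw [Set.uIoc_of_le (by linarith)] at hy
        exact boundR R y hR (norm_newmanKernel_vertical hR (abs_of_pos hR)
          (abs_le.mpr ⟨by linarith [hy.1], by linarith [hy.2]⟩))
    refine this.trans_eq ?_
    rw [sub_neg_eq_add, abs_of_pos (by linarith)]; field_simp; ring
  have e0 : 2 * Real.pi * ‖∑ n ∈ Finset.Icc 1 N, a n / n‖ = ‖2 * Real.pi * I * V 0‖ := by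
    rw [← hV0]
    simp [abs_of_pos Real.pi_pos]
  rw [e0, id1]
  have tri : ∀ p q r p' q' r' t : ℂ, ‖(p - q - I * r) + (p' - q' + I * r') + I * t‖ ≤
      ‖p‖ + ‖q‖ + ‖r‖ + ‖p'‖ + ‖q'‖ + ‖r'‖ + ‖t‖ := by
    intro p q r p' q' r' t
    have hI : ∀ z : ℂ, ‖I * z‖ = ‖z‖ := by simp
    linarith [norm_add_le ((p - q - I * r) + (p' - q' + I * r')) (I * t),
      norm_add_le (p - q - I * r) (p' - q' + I * r'), norm_sub_le (p - q) (I * r),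
      norm_sub_le p q, norm_add_le (p' - q') (I * r'), norm_sub_le p' q', hI r, hI r', hI t]
  refine (tri _ _ _ _ _ _ _).trans ?_
  have : 36 * C / R = 6 * C / R + 6 * C / R + 12 * C / R + 3 * C / R + 3 * C / R + 6 * C / R := by
    ring
  rw [this]
  gcongr

/-- **Newman's Tauberian theorem**, normalised so that the sum of the series is zero: if `a` is
bounded and `∑ a n / n ^ (1 + s) = s * h s` with `h` continuous on `0 ≤ Re s` (and holomorphic
inside), then `∑ a n / n` converges to `0`. -/
theorem tendsto_sum_div_natCast_zero {a : ℕ → ℂ} {C : ℝ} (ha : ∀ n, ‖a n‖ ≤ C) {h : ℂ → ℂ}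
    (hc : ContinuousOn h {s | 0 ≤ s.re}) (hd : DifferentiableOn ℂ h {s | 0 < s.re})
    (hL : ∀ s : ℂ, 0 < s.re → LSeries a (1 + s) = s * h s) :
    Tendsto (fun N : ℕ => ∑ n ∈ Finset.Icc 1 N, a n / n) atTop (𝓝 0) := by
  have hC : 0 ≤ C := (norm_nonneg _).trans (ha 0)
  rw [Metric.tendsto_atTop']
  intro ε hε
  -- This makes 36C/R ≤ ε. With the integral below ε, the sum is less than 2ε/(2π) < ε.
  set R : ℝ := 36 * (C + 1) / ε with hRdef
  have hR : 0 < R := by positivity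
  have lim := tendsto_integral_mul_exp_log (R := R) (by linarith)
    (fun y => h (y * I) * (1 + (y * I) ^ 2 / R ^ 2))
  have ev := (Metric.tendsto_nhds.mp lim ε hε).and
    ((eventually_ge_atTop ⌈R⌉₊).and (eventually_gt_atTop 0))
  obtain ⟨N₀, hN₀⟩ := eventually_atTop.mp ev
  refine ⟨N₀, fun N hN => ?_⟩
  obtain ⟨h1, h2, _⟩ := hN₀ N hN.le
  rw [dist_zero_right] at h1 ⊢
  have h3 := two_pi_mul_norm_sum_div_le ha hc hd hL hR
    ((Nat.le_ceil R).trans (by exact_mod_cast h2))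
  have h4 : 36 * C / R ≤ ε := by
    rw [div_le_iff₀ hR, hRdef, mul_div_cancel₀ _ hε.ne']; linarith
  have h5 := Real.pi_gt_three
  nlinarith [norm_nonneg (∑ n ∈ Finset.Icc 1 N, a n / n)]

end Tauberian

/-! ### The reciprocal of L and the prime number theorem for χ. -/

section EntireL

open Complex DirichletCharacter

/-- The factor which removes the pole of `L(s, χ)` for a primitive character modulo `q`. -/
noncomputable def poleFactor (q : ℕ) (w : ℂ) : ℂ := if q = 1 then w - 1 else 1

/-- The entire function `poleFactor q w * L(w, χ)`. -/
noncomputable def entireL {q : ℕ} [NeZero q] (χ : DirichletCharacter ℂ q) (w : ℂ) : ℂ :=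
  if q = 1 then LFunctionTrivChar₁ q w else χ.LFunction w

lemma differentiable_poleFactor (q : ℕ) : Differentiable ℂ (poleFactor q) := by
  unfold poleFactor
  split_ifs <;> fun_prop

lemma poleFactor_ne_zero {q : ℕ} {w : ℂ} (hw : w ≠ 1) : poleFactor q w ≠ 0 := by
  unfold poleFactor
  split_ifs
  · exact sub_ne_zero.mpr hw
  · exact one_ne_zero

lemma norm_poleFactor_le (q : ℕ) (w : ℂ) : ‖poleFactor q w‖ ≤ 1 + ‖w‖ := by
  unfold poleFactor
  split_ifs
  · exact (norm_sub_le _ _).trans (by simp [add_comm])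
  · simp

lemma ne_one_of_isPrimitive {q : ℕ} [NeZero q] {χ : DirichletCharacter ℂ q}
    (hχ : χ.IsPrimitive) (hq : q ≠ 1) :
    χ ≠ 1 := by
  rintro rfl
  rw [isPrimitive_def, conductor_one] at hχ
  exact hq hχ.symm

lemma differentiable_entireL {q : ℕ} [NeZero q] {χ : DirichletCharacter ℂ q} (hχ : χ.IsPrimitive) :
    Differentiable ℂ (entireL χ) := by
  unfold entireL
  split_ifs with h
  · exact differentiable_LFunctionTrivChar₁ q
  · exact differentiable_LFunction (ne_one_of_isPrimitive hχ h)

lemma entireL_eq_mul {q : ℕ} [NeZero q] (χ : DirichletCharacter ℂ q) {w : ℂ} (hw : w ≠ 1) :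
    entireL χ w = poleFactor q w * χ.LFunction w := by
  unfold entireL poleFactor
  split_ifs with h
  · rw [LFunctionTrivChar₁, Function.update_of_ne hw, LFunctionTrivChar, level_one' χ h]
  · rw [one_mul]

/-- The arithmetic input to the Tauberian argument is the line Re w = 1. At a pole the value is the
residue, which is nonzero. -/
lemma entireL_ne_zero_of_one_le_re {q : ℕ} [NeZero q] {χ : DirichletCharacter ℂ q}
    (hχ : χ.IsPrimitive) {w : ℂ} (hw : 1 ≤ w.re) : entireL χ w ≠ 0 := by
  by_cases h1 : w = 1
  · unfold entireL
    split_ifs with h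
    · rw [h1]; exact LFunctionTrivChar₁_apply_one_ne_zero q
    · exact LFunction_ne_zero_of_one_le_re χ (.inl (ne_one_of_isPrimitive hχ h)) hw
  · rw [entireL_eq_mul χ h1]
    exact mul_ne_zero (poleFactor_ne_zero h1) (LFunction_ne_zero_of_one_le_re χ (.inr h1) hw)

/-- The coefficients `χ(n) μ(n)`. -/
noncomputable def twistedMoebius {q : ℕ} (χ : DirichletCharacter ℂ q) (n : ℕ) : ℂ :=
  χ (n : ZMod q) * (ArithmeticFunction.moebius n : ℂ)

lemma norm_twistedMoebius_le {q : ℕ} (χ : DirichletCharacter ℂ q) (n : ℕ) :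
    ‖twistedMoebius χ n‖ ≤ 1 := by
  rw [twistedMoebius, norm_mul]
  refine mul_le_one₀ (χ.norm_le_one _) (norm_nonneg _) ?_
  rw [norm_intCast]
  exact_mod_cast ArithmeticFunction.abs_moebius_le_one

/-- `1 / L(w, χ)`, with the removable singularity at a pole of `L` removed. -/
noncomputable def invL {q : ℕ} [NeZero q] (χ : DirichletCharacter ℂ q) (w : ℂ) : ℂ :=
  poleFactor q w / entireL χ w

lemma invL_eq_LSeries {q : ℕ} [NeZero q] {χ : DirichletCharacter ℂ q}
    (hχ : χ.IsPrimitive) {w : ℂ} (hw : 1 < w.re) :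
    invL χ w = LSeries (twistedMoebius χ) w := by
  have h1 : w ≠ 1 := by rintro rfl; simp at hw
  have h := LSeries.mul_mu_eq_one χ hw
  have e : LSeries (twistedMoebius χ) w =
    LSeries ((fun n : ℕ => χ (n : ZMod q)) * (fun n : ℕ => (ArithmeticFunction.moebius n : ℂ))) w :=
    rfl
  rw [invL, div_eq_iff (entireL_ne_zero_of_one_le_re hχ hw.le), entireL_eq_mul χ h1,
    LFunction_eq_LSeries χ hw, e]
  linear_combination (-poleFactor q w) * h

lemma differentiableAt_invL {q : ℕ} [NeZero q] {χ : DirichletCharacter ℂ q}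
    (hχ : χ.IsPrimitive) {w : ℂ}
    (hw : entireL χ w ≠ 0) : DifferentiableAt ℂ (invL χ) w :=
  ((differentiable_poleFactor q) w).div (differentiable_entireL hχ w) hw

/-- The prime number theorem for `χ`, in the form `∑ χ(n) μ(n) / n = 1 / L(1, χ)`. -/
theorem tendsto_sum_twistedMoebius_div {q : ℕ} [NeZero q] {χ : DirichletCharacter ℂ q}
    (hχ : χ.IsPrimitive) :
    Tendsto (fun N : ℕ => ∑ n ∈ Finset.Icc 1 N, twistedMoebius χ n / n) atTop
      (𝓝 (invL χ 1)) := by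
  set G := invL χ 1 with hG
  -- Changing only the coefficient at n = 1 subtracts the expected limit, so the continued series
  -- vanishes at s = 0 and its quotient by s is the slope of `g`.
  set a : ℕ → ℂ := twistedMoebius χ - G • LSeries.delta with ha
  have hab : ∀ n, ‖a n‖ ≤ 1 + ‖G‖ := by
    intro n
    refine (norm_sub_le _ _).trans (add_le_add (norm_twistedMoebius_le χ n) ?_)
    simp only [Pi.smul_apply, smul_eq_mul, norm_mul, LSeries.delta]
    split_ifs <;> simp
  set g : ℂ → ℂ := fun s => invL χ (1 + s) with hg
  have hdiff : ∀ s : ℂ, 0 ≤ s.re → DifferentiableAt ℂ g s := by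
    intro s hs
    have : DifferentiableAt ℂ (invL χ) (1 + s) :=
      differentiableAt_invL hχ (entireL_ne_zero_of_one_le_re hχ (by simpa using hs))
    exact this.comp s (by fun_prop)
  have hcont : ∀ s : ℂ, 0 ≤ s.re → ContinuousAt (dslope g 0) s := by
    intro s hs
    by_cases h0 : s = 0
    · rw [h0, continuousAt_dslope_same]; exact hdiff 0 (by simp)
    · rw [continuousAt_dslope_of_ne h0]; exact (hdiff s hs).continuousAt
  have key := tendsto_sum_div_natCast_zero hab (h := dslope g 0)
    (fun s hs => (hcont s hs).continuousWithinAt)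
    (fun s hs => by
      have h0 : s ≠ 0 := by rintro rfl; simp at hs
      exact ((differentiableAt_dslope_of_ne h0).mpr (hdiff s (le_of_lt hs))).differentiableWithinAt)
    (fun s hs => by
      have h0 : s ≠ 0 := by rintro rfl; simp at hs
      have hs1 : 1 < (1 + s).re := by simpa using hs
      rw [dslope_of_ne _ h0, slope_def_field, sub_zero, mul_div_cancel₀ _ h0, ha,
        LSeries_sub, LSeries_smul, LSeries_delta, hg]
      · simp [invL_eq_LSeries hχ hs1, ← hG]
      · exact LSeriesSummable_of_bounded_of_one_lt_re
          (fun n _ => norm_twistedMoebius_le χ n) hs1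
      · exact LSeriesSummable_of_bounded_of_one_lt_re (m := ‖G‖) (fun n _ => by
          simp only [Pi.smul_apply, smul_eq_mul, norm_mul, LSeries.delta]
          split_ifs <;> simp) hs1)
  have := key.add_const G
  rw [zero_add] at this
  refine this.congr' ((eventually_ge_atTop 1).mono fun N hN => ?_)
  have : ∑ n ∈ Finset.Icc 1 N, G * LSeries.delta n / n = G := by
    rw [Finset.sum_eq_single 1]
    · simp [LSeries.delta]
    · intro n _ hn; simp [LSeries.delta, hn]
    · intro h; simp [hN] at h
  simp only [ha, Pi.sub_apply, Pi.smul_apply, smul_eq_mul, sub_div, Finset.sum_sub_distrib, this]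
  ring

end EntireL

/-! ### Polynomial growth of L by partial summation. -/

section Growth

open Complex DirichletCharacter MeasureTheory

/-- A full period sums to zero by orthogonality, so the sum is periodic in its length and fewer than
q terms survive. -/
lemma norm_sum_Icc_le_level {q : ℕ} [NeZero q] {χ : DirichletCharacter ℂ q} (hq : q ≠ 1)
    (hχ : χ ≠ 1) (n : ℕ) : ‖∑ k ∈ Finset.Icc 1 n, χ (k : ZMod q)‖ ≤ q := by
  have hqpos : 0 < q := NeZero.pos q
  set F : ℕ → ℂ := fun n => ∑ k ∈ Finset.range n, χ (k : ZMod q) with hF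
  have hFq : F q = 0 := by
    have h := χ.sum_eq_zero_of_ne_one hχ
    rw [← h]
    refine Finset.sum_bij (fun k _ => (k : ZMod q)) (fun _ _ => Finset.mem_univ _) ?_ ?_
      (fun _ _ => rfl)
    · intro a ha b hb hab
      rw [ZMod.natCast_eq_natCast_iff] at hab
      exact Nat.ModEq.eq_of_lt_of_lt hab (Finset.mem_range.mp ha) (Finset.mem_range.mp hb)
    · intro b _
      exact ⟨b.val, Finset.mem_range.mpr (ZMod.val_lt b), ZMod.natCast_zmod_val b⟩
  have hper : Function.Periodic F q := by
    intro n
    have : F (q + n) = F q + F n := by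
      simp only [hF, Finset.sum_range_add]
      simp
    rw [add_comm, this, hFq, zero_add]
  have h0 : χ ((0 : ℕ) : ZMod q) = 0 := by
    simpa using χ.map_zero' hq
  have e : ∑ k ∈ Finset.Icc 1 n, χ (k : ZMod q) = F (n + 1) := by
    have : Finset.range (n + 1) = insert 0 (Finset.Icc 1 n) := by
      ext k; simp only [Finset.mem_range, Finset.mem_insert, Finset.mem_Icc]; omega
    simp only [hF]
    rw [this, Finset.sum_insert (by simp), h0, zero_add]
  rw [e, ← hper.map_mod_nat]
  refine (norm_sum_le _ _).trans ?_
  calc ∑ k ∈ Finset.range ((n + 1) % q), ‖χ (k : ZMod q)‖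
      ≤ ∑ k ∈ Finset.range ((n + 1) % q), (1 : ℝ) :=
        Finset.sum_le_sum fun k _ => χ.norm_le_one _
    _ ≤ q := by
      simp only [Finset.sum_const, Finset.card_range, nsmul_eq_mul, mul_one]
      exact_mod_cast (Nat.mod_lt _ hqpos).le

/-- The residue of `L(s, χ)` at `s = 1` for a primitive character modulo `q`. -/
noncomputable def primitiveResidue (q : ℕ) : ℂ := if q = 1 then 1 else 0

/-- The error in `∑ n ≤ t, χ(n) = primitiveResidue q * t + O(1)`, cut off to `t > 1`. -/
noncomputable def characterSumError {q : ℕ} (χ : DirichletCharacter ℂ q) : ℝ → ℂ :=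
  (Set.Ioi 1).indicator fun t =>
    ∑ k ∈ Finset.Icc 1 ⌊t⌋₊, χ (k : ZMod q) - primitiveResidue q * t

lemma norm_characterSumError_le {q : ℕ} [NeZero q] {χ : DirichletCharacter ℂ q}
    (hχ : χ.IsPrimitive) (t : ℝ) : ‖characterSumError χ t‖ ≤ q := by
  unfold characterSumError
  by_cases ht : t ∈ Set.Ioi (1 : ℝ)
  swap
  · rw [Set.indicator_of_notMem ht, norm_zero]; positivity
  rw [Set.indicator_of_mem ht]
  unfold primitiveResidue
  split_ifs with hq
  · subst hq
    have ht0 : 0 ≤ t := zero_le_one.trans (le_of_lt ht)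
    have e : ∀ k : ℕ, χ (k : ZMod 1) = 1 := fun k => by
      rw [Subsingleton.elim (k : ZMod 1) 1, map_one]
    have : (∑ k ∈ Finset.Icc 1 ⌊t⌋₊, χ (k : ZMod 1) - 1 * t : ℂ) = ((⌊t⌋₊ - t : ℝ) : ℂ) := by
      simp [e]
    rw [this, norm_real, Real.norm_eq_abs, abs_le]
    constructor
    · have := Nat.lt_floor_add_one t
      push_cast; linarith
    · have := Nat.floor_le ht0
      push_cast; linarith
  · rw [zero_mul, sub_zero]
    exact norm_sum_Icc_le_level hq (ne_one_of_isPrimitive hχ hq) _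

lemma measurable_characterSumError {q : ℕ} (χ : DirichletCharacter ℂ q) :
    Measurable (characterSumError χ) := by
  refine Measurable.indicator ?_ measurableSet_Ioi
  refine Measurable.sub ?_ (by fun_prop)
  exact (measurable_from_nat (f := fun n => ∑ k ∈ Finset.Icc 1 n, χ (k : ZMod q))).comp
    Nat.measurable_floor

lemma mellin_characterSumError {q : ℕ} (χ : DirichletCharacter ℂ q) (s : ℂ) :
    mellin (characterSumError χ) (-s) = ∫ t in Set.Ioi (1 : ℝ),
      (∑ k ∈ Finset.Icc 1 ⌊t⌋₊, χ (k : ZMod q) - primitiveResidue q * t) *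
        (t : ℂ) ^ (-(s + 1)) := by
  have : ∀ t : ℝ, (t : ℂ) ^ (-s - 1) • characterSumError χ t = (Set.Ioi (1 : ℝ)).indicator
      (fun t : ℝ => (∑ k ∈ Finset.Icc 1 ⌊t⌋₊, χ (k : ZMod q) - primitiveResidue q * t) *
        (t : ℂ) ^ (-(s + 1))) t := by
    intro t
    unfold characterSumError
    by_cases ht : t ∈ Set.Ioi (1 : ℝ)
    · rw [Set.indicator_of_mem ht, Set.indicator_of_mem ht, smul_eq_mul, mul_comm]
      congr 2; ring
    · rw [Set.indicator_of_notMem ht, Set.indicator_of_notMem ht, smul_zero]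
  rw [mellin]
  simp only [this]
  rw [setIntegral_indicator measurableSet_Ioi]
  congr 2
  ext t; simp only [Set.mem_inter_iff, Set.mem_Ioi]; constructor
  · exact fun h => h.2
  · exact fun h => ⟨by linarith, h⟩

lemma differentiableAt_mellin_characterSumError {q : ℕ} [NeZero q] {χ : DirichletCharacter ℂ q}
    (hχ : χ.IsPrimitive) {s : ℂ} (hs : s.re < 0) :
    DifferentiableAt ℂ (mellin (characterSumError χ)) s := by
  -- The cut-off makes the function vanish near 0, so any exponent below Re s serves as `b`.
  refine mellin_differentiableAt_of_isBigO_rpow (a := 0) (b := s.re - 1) ?_ ?_ hs ?_ (by linarith)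
  · refine LocallyIntegrable.locallyIntegrableOn ?_ _
    refine (locallyIntegrable_const (q : ℝ)).mono
      (measurable_characterSumError χ).aestronglyMeasurable (.of_forall fun t => ?_)
    simpa using norm_characterSumError_le hχ t
  · refine IsBigO.of_bound q (.of_forall fun t => ?_)
    simpa using norm_characterSumError_le hχ t
  · refine IsBigO.of_bound 0 ?_
    filter_upwards [Ioo_mem_nhdsGT (zero_lt_one (α := ℝ))] with t ht
    rw [characterSumError, Set.indicator_of_notMem (by simpa using ht.2.le)]
    simp

lemma norm_mellin_characterSumError_le {q : ℕ} [NeZero q] {χ : DirichletCharacter ℂ q}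
    (hχ : χ.IsPrimitive) {s : ℂ} (hs : 0 < s.re) :
    ‖mellin (characterSumError χ) (-s)‖ ≤ q / s.re := by
  have hint : IntegrableOn (fun t : ℝ => (q : ℝ) * t ^ (-s.re - 1)) (Set.Ioi 1) :=
    (integrableOn_Ioi_rpow_of_lt (by linarith) zero_lt_one).const_mul _
  rw [mellin_characterSumError]
  refine (norm_integral_le_of_norm_le hint ?_).trans_eq ?_
  · filter_upwards [ae_restrict_mem measurableSet_Ioi] with t ht
    have h1 := norm_characterSumError_le hχ t
    rw [characterSumError, Set.indicator_of_mem ht] at h1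
    have ht0 : 0 < t := zero_lt_one.trans ht
    rw [norm_mul, norm_cpow_eq_rpow_re_of_pos ht0]
    have : (-(s + 1)).re = -s.re - 1 := by simp; ring
    rw [this]
    gcongr
  · rw [integral_const_mul, integral_Ioi_rpow_of_lt (by linarith) zero_lt_one]
    simp
    rfl

/-- Abel summation writes L(s,χ) as s times the integral of the character sum against t^(-s-1); the
main term of that sum integrates to 1/(s-1) times the residue. -/
lemma LFunction_eq_mul_mellin {q : ℕ} [NeZero q] {χ : DirichletCharacter ℂ q}
    (hχ : χ.IsPrimitive) {s : ℂ} (hs : 1 < s.re) :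
    χ.LFunction s = s * mellin (characterSumError χ) (-s) + primitiveResidue q * (s / (s - 1)) := by
  have hs0 : 0 < s.re := by linarith
  have hO : (fun n : ℕ => ∑ k ∈ Finset.Icc 1 n, χ (k : ZMod q)) =O[atTop]
      fun n : ℕ => (n : ℝ) ^ (1 : ℝ) := by
    refine IsBigO.of_bound 1 (.of_forall fun n => ?_)
    refine (norm_sum_le _ _).trans ((Finset.sum_le_sum fun k _ => χ.norm_le_one _).trans ?_)
    simp
  have h := LSeries_eq_mul_integral (fun n : ℕ => χ (n : ZMod q)) zero_le_one hs
    (LSeriesSummable_of_one_lt_re χ hs) hO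
  have hcpow : ∫ t in Set.Ioi (1 : ℝ), (t : ℂ) ^ (-s) = 1 / (s - 1) := by
    rw [integral_Ioi_cpow_of_lt (by simpa using hs) zero_lt_one]
    have : s - 1 ≠ 0 := sub_ne_zero.mpr (by rintro rfl; simp at hs)
    have : -s + 1 ≠ 0 := by intro h; apply this; linear_combination -h
    simp
    field_simp
    ring
  have hi1 : IntegrableOn (fun t : ℝ => (t : ℂ) ^ (-s)) (Set.Ioi 1) :=
    integrableOn_Ioi_cpow_of_lt (by simpa using hs) zero_lt_one
  have hi2 : IntegrableOn (fun t : ℝ => (∑ k ∈ Finset.Icc 1 ⌊t⌋₊, χ (k : ZMod q) -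
      primitiveResidue q * t) * (t : ℂ) ^ (-(s + 1))) (Set.Ioi 1) := by
    have hint : IntegrableOn (fun t : ℝ => (q : ℝ) * t ^ (-s.re - 1)) (Set.Ioi 1) :=
      (integrableOn_Ioi_rpow_of_lt (by linarith) zero_lt_one).const_mul _
    refine Integrable.mono' hint ?_ ?_
    · refine Measurable.aestronglyMeasurable ?_
      refine Measurable.mul (Measurable.sub ?_ (by fun_prop)) (by fun_prop)
      exact (measurable_from_nat (f := fun n => ∑ k ∈ Finset.Icc 1 n, χ (k : ZMod q))).comp
        Nat.measurable_floor
    · filter_upwards [ae_restrict_mem measurableSet_Ioi] with t ht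
      have h1 := norm_characterSumError_le hχ t
      rw [characterSumError, Set.indicator_of_mem ht] at h1
      have ht0 : 0 < t := zero_lt_one.trans ht
      rw [norm_mul, norm_cpow_eq_rpow_re_of_pos ht0]
      have : (-(s + 1)).re = -s.re - 1 := by simp; ring
      rw [this]
      gcongr
  have split : ∫ t in Set.Ioi (1 : ℝ), (∑ k ∈ Finset.Icc 1 ⌊t⌋₊, χ (k : ZMod q)) *
      (t : ℂ) ^ (-(s + 1)) =
        mellin (characterSumError χ) (-s) + primitiveResidue q * (1 / (s - 1)) := by
    rw [mellin_characterSumError, ← hcpow, ← integral_const_mul,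
      ← integral_add hi2 (hi1.const_mul _)]
    refine setIntegral_congr_fun measurableSet_Ioi fun t ht => ?_
    have ht0 : (t : ℂ) ≠ 0 := by exact_mod_cast (zero_lt_one.trans ht).ne'
    have : (t : ℂ) ^ (-s) = t * (t : ℂ) ^ (-(s + 1)) := by
      rw [show -s = 1 + -(s + 1) by ring, cpow_add _ _ ht0, cpow_one]
    simp only [this]
    ring
  rw [LFunction_eq_LSeries χ hs, h, split]
  ring

/-- The error term is bounded, so its Mellin transform is analytic on all of Re s > 0; with the pole
cleared, the identity extends from Re s > 1 by analytic continuation. -/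
lemma entireL_eq_mellin {q : ℕ} [NeZero q] {χ : DirichletCharacter ℂ q} (hχ : χ.IsPrimitive)
    {s : ℂ} (hs : 0 < s.re) :
    entireL χ s = poleFactor q s * (s * mellin (characterSumError χ) (-s)) +
      primitiveResidue q * s := by
  have hU : IsOpen {s : ℂ | 0 < s.re} := isOpen_lt continuous_const continuous_re
  have hpre : IsPreconnected {s : ℂ | 0 < s.re} := (convex_halfSpace_re_gt 0).isPreconnected
  have h1 : AnalyticOnNhd ℂ (entireL χ) {s : ℂ | 0 < s.re} :=
    (differentiable_entireL hχ).differentiableOn.analyticOnNhd hU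
  have h2 : AnalyticOnNhd ℂ (fun s => poleFactor q s * (s * mellin (characterSumError χ) (-s)) +
      primitiveResidue q * s) {s : ℂ | 0 < s.re} := by
    refine DifferentiableOn.analyticOnNhd (fun z hz =>
      DifferentiableAt.differentiableWithinAt ?_) hU
    have hm : DifferentiableAt ℂ (fun s => mellin (characterSumError χ) (-s)) z :=
      DifferentiableAt.comp (g := mellin (characterSumError χ)) z
        (differentiableAt_mellin_characterSumError hχ (by simpa using hz)) (by fun_prop)
    have hp := differentiable_poleFactor q z
    fun_prop
  refine h1.eqOn_of_preconnected_of_eventuallyEq h2 hpre (z₀ := 2) (by simp) ?_ hs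
  have : {s : ℂ | 1 < s.re} ∈ 𝓝 (2 : ℂ) :=
    (isOpen_lt continuous_const continuous_re).mem_nhds (by simp)
  filter_upwards [this] with z hz
  have hz1 : z ≠ 1 := by rintro rfl; simp at hz
  rw [entireL_eq_mul χ hz1, LFunction_eq_mul_mellin hχ hz, mul_add]
  congr 1
  have : z - 1 ≠ 0 := sub_ne_zero.mpr hz1
  unfold poleFactor primitiveResidue
  split_ifs
  · field_simp
  · simp

/-- Polynomial growth of `L(w, χ)` in the half-plane `Re w ≥ 1 / 2`. -/
lemma norm_entireL_le {q : ℕ} [NeZero q] {χ : DirichletCharacter ℂ q} (hχ : χ.IsPrimitive)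
    {w : ℂ} (hw : 1 / 2 ≤ w.re) : ‖entireL χ w‖ ≤ (2 * q + 1) * (1 + ‖w‖) ^ 2 := by
  have hw0 : 0 < w.re := by linarith
  have h1 := norm_mellin_characterSumError_le hχ hw0
  have h2 : (q : ℝ) / w.re ≤ 2 * q := by
    rw [div_le_iff₀ hw0]
    have : (0 : ℝ) ≤ q := by positivity
    nlinarith
  have h3 : ‖primitiveResidue q‖ ≤ 1 := by
    unfold primitiveResidue; split_ifs <;> simp
  rw [entireL_eq_mellin hχ hw0]
  calc _ ≤ ‖poleFactor q w‖ * (‖w‖ * ‖mellin (characterSumError χ) (-w)‖) +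
        ‖primitiveResidue q‖ * ‖w‖ := by
        refine (norm_add_le _ _).trans_eq ?_
        simp only [norm_mul]
    _ ≤ (1 + ‖w‖) * (‖w‖ * (2 * q)) + 1 * ‖w‖ := by
        gcongr
        · exact norm_poleFactor_le q w
        · exact h1.trans h2
    _ ≤ _ := by
        have : (0 : ℝ) ≤ q := by positivity
        have := norm_nonneg w
        nlinarith [mul_nonneg ‹(0 : ℝ) ≤ q› this]

end Growth

/-! ### Bounds for 1/L in a zero-free half-plane. -/

section InverseBound

open Complex

/-- A zero-free holomorphic function on a ball is the exponential of a holomorphic function, up to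
its value at the centre. -/
lemma exists_log_of_ne_zero_on_ball {f : ℂ → ℂ} {c : ℂ} {R : ℝ} (hR : 0 < R)
    (hf : DifferentiableOn ℂ f (Metric.ball c R)) (hne : ∀ z ∈ Metric.ball c R, f z ≠ 0) :
    ∃ g : ℂ → ℂ, DifferentiableOn ℂ g (Metric.ball c R) ∧ g c = 0 ∧
      ∀ z ∈ Metric.ball c R, f z = f c * exp (g z) := by
  have hc : c ∈ Metric.ball c R := Metric.mem_ball_self hR
  have hd : DifferentiableOn ℂ (fun z => deriv f z / f z) (Metric.ball c R) :=
    (hf.deriv Metric.isOpen_ball).div hf hne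
  obtain ⟨g, hg⟩ := hd.isExactOn_ball
  refine ⟨fun z => g z - g c, fun z hz =>
    ((hg z hz).sub_const _).differentiableAt.differentiableWithinAt, sub_self _, ?_⟩
  set F : ℂ → ℂ := fun z => f z * exp (-(g z - g c)) with hF
  have hFd : ∀ z ∈ Metric.ball c R, HasDerivAt F 0 z := by
    intro z hz
    have h1 := (hf.differentiableAt (Metric.isOpen_ball.mem_nhds hz)).hasDerivAt
    have h2 := (((hg z hz).sub_const (g c)).neg).cexp
    refine (h1.mul h2).congr_deriv ?_
    have := hne z hz
    simp only [Pi.neg_apply]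
    field_simp
    ring
  intro z hz
  have hconst : F z = F c := by
    refine Metric.isOpen_ball.is_const_of_deriv_eq_zero (convex_ball c R).isPreconnected
      (fun z hz => (hFd z hz).differentiableAt.differentiableWithinAt)
      (fun z hz => (hFd z hz).deriv) hz hc
  simp only [hF, sub_self, exp_neg, exp_zero, inv_one, mul_one] at hconst
  rw [← hconst, mul_assoc, inv_mul_cancel₀ (exp_ne_zero _), mul_one]

/-- Lower bound for a zero-free holomorphic function, from Borel–Carathéodory. -/
lemma norm_inv_le_of_norm_le_on_ball {f : ℂ → ℂ} {c z : ℂ} {R r M : ℝ} (hr : 0 ≤ r) (hrR : r < R)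
    (hM : 1 < M) (hf : DifferentiableOn ℂ f (Metric.ball c R))
    (hne : ∀ z ∈ Metric.ball c R, f z ≠ 0)
    (hbound : ∀ z ∈ Metric.ball c R, ‖f z‖ ≤ M * ‖f c‖) (hz : ‖z - c‖ ≤ r) :
    ‖(f z)⁻¹‖ ≤ ‖(f c)⁻¹‖ * M ^ (2 * r / (R - r)) := by
  have hR : 0 < R := hr.trans_lt hrR
  have hzb : z ∈ Metric.ball c R := by rw [mem_ball_iff_norm]; linarith
  have hlog : 0 < Real.log M := Real.log_pos hM
  obtain ⟨g, hgd, hgc, hg⟩ := exists_log_of_ne_zero_on_ball hR hf hne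
  have hmap : ∀ u : ℂ, u ∈ Metric.ball (0 : ℂ) R → c + u ∈ Metric.ball c R := by
    intro u hu; simpa [mem_ball_iff_norm] using hu
  -- The hypothesis |f| ≤ M|f(c)| says Re g ≤ log M, which Borel–Carathéodory upgrades to a bound on
  -- |g|, hence on Re(-g).
  have hb := borelCaratheodory_zero (f := fun u => g (c + u)) (z := z - c) hlog
    (hgd.comp (by fun_prop) hmap) (fun u hu => by
      have h1 := hbound _ (hmap u hu)
      have h2 : 0 < ‖f c‖ := norm_pos_iff.mpr (hne c (Metric.mem_ball_self hR))
      rw [hg _ (hmap u hu), norm_mul, mul_comm, mul_le_mul_iff_left₀ h2, norm_exp] at h1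
      exact (Real.le_log_iff_exp_le (by linarith)).mpr h1) hR (by rw [mem_ball_zero_iff]; linarith)
    (by simpa using hgc)
  simp only [add_sub_cancel] at hb
  have hb2 : ‖g z‖ ≤ Real.log M * (2 * r / (R - r)) := by
    refine hb.trans ?_
    have : 2 * Real.log M * ‖z - c‖ / (R - ‖z - c‖) ≤ 2 * Real.log M * r / (R - r) := by
      have : 0 < R - r := by linarith
      gcongr
    exact this.trans_eq (by ring)
  rw [hg z hzb, mul_inv, norm_mul, ← exp_neg, norm_exp, Real.rpow_def_of_pos (by linarith)]
  gcongr
  rw [neg_re]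
  exact (neg_le_abs _).trans ((abs_re_le_norm _).trans hb2)

lemma exists_norm_invL_le_of_two_le_re {q : ℕ} [NeZero q] {χ : DirichletCharacter ℂ q}
    (hχ : χ.IsPrimitive) : ∃ B : ℝ, 1 ≤ B ∧ ∀ w : ℂ, 2 ≤ w.re → ‖invL χ w‖ ≤ B := by
  have hs : LSeriesSummable (1 : ℕ → ℂ) 2 := LSeriesSummable_one_iff.mpr (by simp)
  refine ⟨max 1 (∑' n, ‖LSeries.term (1 : ℕ → ℂ) 2 n‖), le_max_left _ _, fun w hw => ?_⟩
  rw [invL_eq_LSeries hχ (by linarith)]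
  refine le_trans ?_ (le_max_right _ _)
  refine tsum_of_norm_bounded hs.norm.hasSum fun n => ?_
  refine (LSeries.norm_term_le w (g := 1) ?_).trans ?_
  · simpa using norm_twistedMoebius_le χ n
  · exact LSeries.norm_term_le_of_re_le_re 1 (by simpa using hw) n

/-- If `L(w, χ)` has no zeros in `Re w > 1 / 2`, then `1 / L(w, χ)` has polynomial growth in each
half-plane `Re w ≥ 1 / 2 + δ`. -/
theorem exists_norm_invL_le {q : ℕ} [NeZero q] {χ : DirichletCharacter ℂ q} (hχ : χ.IsPrimitive)
    (hne : ∀ w : ℂ, 1 / 2 < w.re → entireL χ w ≠ 0) {δ : ℝ} (hδ : 0 < δ) :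
    ∃ (C : ℝ) (A : ℕ), 0 ≤ C ∧
      ∀ w : ℂ, 1 / 2 + δ ≤ w.re → ‖invL χ w‖ ≤ C * (1 + |w.im|) ^ A := by
  obtain ⟨B, hB1, hB⟩ := exists_norm_invL_le_of_two_le_re hχ
  -- With radii R = 3/2 and r = 3/2 - δ the exponent 2r/(R-r) is (3-2δ)/δ ≤ 3/δ.
  set A : ℕ := ⌈3 / δ⌉₊ with hA
  have hq0 : (0 : ℝ) ≤ q := by positivity
  -- The 25 is the square of 5 in 1+|z| ≤ 5(1+|t|) on the disc; B compensates for dividing by the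
  -- value at the centre.
  set K : ℝ := (2 * q + 1) * 25 * B with hK
  have hK1 : 1 < K := by nlinarith
  refine ⟨4 * B * K ^ A, 2 * A + 1, by positivity, fun w hw => ?_⟩
  have ht : 1 ≤ 1 + |w.im| := by linarith [abs_nonneg w.im]
  have hKA : 1 ≤ K ^ A := one_le_pow₀ hK1.le
  rcases le_total 2 w.re with h2 | h2
  · have h1 : 1 ≤ (1 + |w.im|) ^ (2 * A + 1) := one_le_pow₀ ht
    calc ‖invL χ w‖ ≤ B := hB w h2
      _ ≤ 4 * B * 1 * 1 := by linarith
      _ ≤ _ := by gcongr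
  set t := w.im with ht'
  -- The disc of radius 3/2 about 2+it is tangent to the line Re = 1/2, and w lies on its horizontal
  -- diameter.
  set c : ℂ := 2 + t * I with hc
  have hcre : c.re = 2 := by simp [hc]
  have hcim : c.im = t := by simp [hc]
  have hcw : ‖w - c‖ = 2 - w.re := by
    have : w - c = ((w.re - 2 : ℝ) : ℂ) := by
      apply Complex.ext <;> simp [hc, ← ht']
    rw [this, norm_real, Real.norm_eq_abs, abs_of_nonpos (by linarith)]; ring
  have hball : ∀ z ∈ Metric.ball c (3 / 2), 1 / 2 < z.re ∧ 1 + ‖z‖ ≤ 5 * (1 + |t|) := by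
    intro z hz
    rw [mem_ball_iff_norm] at hz
    constructor
    · have := (abs_lt.mp ((abs_re_le_norm (z - c)).trans_lt hz)).1
      rw [sub_re, hcre] at this
      linarith
    · have h1 : ‖c‖ ≤ 2 + |t| := (norm_add_le _ _).trans (by simp)
      have h2 : ‖z‖ ≤ ‖z - c‖ + ‖c‖ := by simpa using norm_add_le (z - c) c
      linarith [abs_nonneg t]
  have hfc : ‖(entireL χ c)⁻¹‖ ≤ B := by
    have h1 : ‖invL χ c‖ ≤ B := hB c hcre.ge
    have h2 : 1 ≤ ‖poleFactor q c‖ := by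
      unfold poleFactor
      split_ifs
      · have := abs_re_le_norm (c - 1)
        rw [sub_re, hcre, one_re] at this
        norm_num at this
        exact this
      · simp
    rw [invL, div_eq_mul_inv, norm_mul] at h1
    nlinarith [norm_nonneg (entireL χ c)⁻¹]
  have hfc0 : entireL χ c ≠ 0 := hne c (by rw [hcre]; norm_num)
  have hfcpos : 0 < ‖entireL χ c‖ := norm_pos_iff.mpr hfc0
  have hone : 1 ≤ B * ‖entireL χ c‖ := by
    rw [norm_inv] at hfc
    rwa [← div_le_iff₀ hfcpos, one_div]
  have hM : 1 < K * (1 + |t|) ^ 2 := by nlinarith [one_le_pow₀ (n := 2) ht]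
  have key := norm_inv_le_of_norm_le_on_ball (f := entireL χ) (c := c) (z := w) (R := 3 / 2)
    (r := 3 / 2 - δ) (M := K * (1 + |t|) ^ 2) (by linarith) (by linarith) hM
    (differentiable_entireL hχ).differentiableOn (fun z hz => hne z (hball z hz).1)
    (fun z hz => by
      have h1 := norm_entireL_le hχ (hball z hz).1.le
      calc ‖entireL χ z‖ ≤ (2 * q + 1) * (1 + ‖z‖) ^ 2 * 1 := by rwa [mul_one]
        _ ≤ (2 * q + 1) * (5 * (1 + |t|)) ^ 2 * (B * ‖entireL χ c‖) := by
          gcongr; exact (hball z hz).2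
        _ = _ := by rw [hK]; ring)
    (by rw [hcw]; linarith)
  have hexp : (K * (1 + |t|) ^ 2) ^ (2 * (3 / 2 - δ) / (3 / 2 - (3 / 2 - δ))) ≤
      (K * (1 + |t|) ^ 2) ^ A := by
    rw [← Real.rpow_natCast _ A]
    refine Real.rpow_le_rpow_of_exponent_le hM.le (le_trans ?_ (Nat.le_ceil _))
    rw [sub_sub_cancel]
    gcongr
    linarith
  have hpw : ‖poleFactor q w‖ ≤ 4 * (1 + |t|) := by
    refine (norm_poleFactor_le q w).trans ?_
    have h1 := norm_le_abs_re_add_abs_im w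
    rw [abs_of_nonneg (by linarith : 0 ≤ w.re)] at h1
    linarith [abs_nonneg t]
  rw [invL, div_eq_mul_inv, norm_mul]
  calc ‖poleFactor q w‖ * ‖(entireL χ w)⁻¹‖
      ≤ 4 * (1 + |t|) * (B * (K * (1 + |t|) ^ 2) ^ A) := by
        refine mul_le_mul hpw (key.trans ?_) (norm_nonneg _) (by positivity)
        exact mul_le_mul hfc hexp (by positivity) (by positivity)
    _ = 4 * B * K ^ A * (1 + |t|) ^ (2 * A + 1) := by
        rw [mul_pow, ← pow_mul, pow_succ]; ring

end InverseBound

/-! ### Decay of Γ and shifting of vertical contours. -/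

section VerticalLines

open Complex MeasureTheory

lemma norm_Gamma_le_Gamma_re {s : ℂ} (hs : 0 < s.re) : ‖Gamma s‖ ≤ Real.Gamma s.re := by
  rw [Gamma_eq_integral hs, GammaIntegral, Real.Gamma_eq_integral hs]
  refine (norm_integral_le_integral_norm _).trans_eq ?_
  refine setIntegral_congr_fun measurableSet_Ioi fun x hx => ?_
  simp only [norm_mul, norm_real, norm_cpow_eq_rpow_re_of_pos hx]
  simp

/-- Each use of Γ(s+1) = sΓ(s) trades a unit of real part for one factor |s| ≥ |Im s|. -/
lemma norm_Gamma_mul_im_pow_le (n : ℕ) {s : ℂ} (hs : 0 < s.re) :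
    ‖Gamma s‖ * |s.im| ^ n ≤ Real.Gamma (s.re + n) := by
  induction n generalizing s with
  | zero => simpa using norm_Gamma_le_Gamma_re hs
  | succ n ih =>
    have h := ih (s := s + 1) (by simp; linarith)
    have hs0 : s ≠ 0 := by rintro rfl; simp at hs
    rw [Gamma_add_one s hs0, norm_mul] at h
    have h1 : |s.im| ≤ ‖s‖ := abs_im_le_norm s
    simp only [add_im, one_im, add_zero, add_re, one_re] at h
    calc ‖Gamma s‖ * |s.im| ^ (n + 1) = |s.im| * ‖Gamma s‖ * |s.im| ^ n := by ring
      _ ≤ ‖s‖ * ‖Gamma s‖ * |s.im| ^ n := by gcongr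
      _ ≤ _ := h.trans_eq (by push_cast; ring_nf)

/-- The Gamma function decays faster than any power in vertical strips. -/
lemma exists_norm_Gamma_mul_pow_le {σ₀ : ℝ} (σ₁ : ℝ) (h0 : 0 < σ₀) (n : ℕ) :
    ∃ C : ℝ, 0 ≤ C ∧ ∀ s : ℂ, σ₀ ≤ s.re → s.re ≤ σ₁ → ‖Gamma s‖ * (1 + |s.im|) ^ n ≤ C := by
  have hc : ContinuousOn (fun σ : ℝ => 2 ^ n * (Real.Gamma σ + Real.Gamma (σ + n)))
      (Set.Icc σ₀ σ₁) := by
    intro σ hσ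
    have h1 : 0 < σ := h0.trans_le hσ.1
    have hG : ∀ x : ℝ, 0 < x → ContinuousAt Real.Gamma x := fun x hx =>
      (Real.differentiableAt_Gamma fun m => by
        have : (0 : ℝ) ≤ m := by positivity
        linarith).continuousAt
    have h2 : ContinuousAt (fun σ : ℝ => Real.Gamma (σ + n)) σ :=
      ContinuousAt.comp (g := Real.Gamma) (hG _ (by positivity)) (by fun_prop)
    exact (continuousAt_const.mul ((hG σ h1).add h2)).continuousWithinAt
  obtain ⟨C, hC⟩ := isCompact_Icc.bddAbove_image hc
  refine ⟨max C 0, le_max_right _ _, fun s h1 h2 => le_max_of_le_left ?_⟩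
  have hs : 0 < s.re := h0.trans_le h1
  have hpow : (1 + |s.im|) ^ n ≤ 2 ^ n * (1 + |s.im| ^ n) := by
    have h := abs_nonneg s.im
    rcases le_total |s.im| 1 with h3 | h3
    · calc (1 + |s.im|) ^ n ≤ 2 ^ n := by gcongr; linarith
        _ ≤ 2 ^ n * (1 + |s.im| ^ n) := le_mul_of_one_le_right (by positivity)
            (by linarith [pow_nonneg h n])
    · calc (1 + |s.im|) ^ n ≤ (2 * |s.im|) ^ n := by gcongr; linarith
        _ = 2 ^ n * |s.im| ^ n := mul_pow _ _ _
        _ ≤ 2 ^ n * (1 + |s.im| ^ n) := by gcongr; linarith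
  calc ‖Gamma s‖ * (1 + |s.im|) ^ n ≤ ‖Gamma s‖ * (2 ^ n * (1 + |s.im| ^ n)) := by gcongr
    _ = 2 ^ n * (‖Gamma s‖ + ‖Gamma s‖ * |s.im| ^ n) := by ring
    _ ≤ 2 ^ n * (Real.Gamma s.re + Real.Gamma (s.re + n)) := by
      gcongr
      · exact norm_Gamma_le_Gamma_re hs
      · exact norm_Gamma_mul_im_pow_le n hs
    _ ≤ C := hC ⟨s.re, ⟨h1, h2⟩, rfl⟩

lemma integrable_vertical {G : ℂ → ℂ} {σ C : ℝ} (hd : ∀ s : ℂ, s.re = σ → ContinuousAt G s)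
    (hb : ∀ s : ℂ, s.re = σ → ‖G s‖ ≤ C * (1 + s.im ^ 2)⁻¹) :
    Integrable fun t : ℝ => G (σ + t * I) := by
  refine Integrable.mono' (integrable_inv_one_add_sq.const_mul C) ?_ (.of_forall fun t => ?_)
  · refine Continuous.aestronglyMeasurable ?_
    rw [continuous_iff_continuousAt]
    intro t
    exact ContinuousAt.comp (g := G) (hd _ (by simp)) (by fun_prop)
  · simpa using hb (σ + t * I) (by simp)

/-- Moving the line of integration of a holomorphic function with quadratic decay. -/
lemma integral_vertical_eq {G : ℂ → ℂ} {σ₀ σ₁ C : ℝ} (hσ : σ₀ ≤ σ₁)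
    (hd : ∀ s : ℂ, σ₀ ≤ s.re → s.re ≤ σ₁ → DifferentiableAt ℂ G s)
    (hb : ∀ s : ℂ, σ₀ ≤ s.re → s.re ≤ σ₁ → ‖G s‖ ≤ C * (1 + s.im ^ 2)⁻¹) :
    ∫ t : ℝ, G (σ₀ + t * I) = ∫ t : ℝ, G (σ₁ + t * I) := by
  have i0 : Integrable fun t : ℝ => G (σ₀ + t * I) := integrable_vertical
    (fun s hs => (hd s hs.ge (hs.trans_le hσ)).continuousAt)
    (fun s hs => hb s hs.ge (hs.trans_le hσ))
  have i1 : Integrable fun t : ℝ => G (σ₁ + t * I) := integrable_vertical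
    (fun s hs => (hd s (hσ.trans hs.ge) hs.le).continuousAt)
    (fun s hs => hb s (hσ.trans hs.ge) hs.le)
  have t0 := intervalIntegral_tendsto_integral i0 tendsto_neg_atTop_atBot tendsto_id
  have t1 := intervalIntegral_tendsto_integral i1 tendsto_neg_atTop_atBot tendsto_id
  simp only [id] at t0 t1
  have horiz : ∀ φ : ℝ → ℝ, Tendsto φ atTop (cocompact ℝ) →
      Tendsto (fun T : ℝ => ∫ x in σ₀..σ₁, G (x + φ T * I)) atTop (𝓝 0) := by
    intro φ hφ
    have hsq : Tendsto (fun T : ℝ => C * (1 + φ T ^ 2)⁻¹ * |σ₁ - σ₀|) atTop (𝓝 0) := by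
      have : Tendsto (fun T => 1 + φ T ^ 2) atTop atTop := by
        have h2 : Tendsto (fun T => ‖φ T‖ ^ 2) atTop atTop :=
          (tendsto_pow_atTop two_ne_zero).comp (tendsto_norm_cocompact_atTop.comp hφ)
        simp only [Real.norm_eq_abs, sq_abs] at h2
        exact tendsto_atTop_add_const_left _ _ h2
      simpa using (this.inv_tendsto_atTop.const_mul C).mul_const |σ₁ - σ₀|
    refine squeeze_zero_norm (fun T => ?_) hsq
    refine intervalIntegral.norm_integral_le_of_norm_le_const fun x hx => ?_
    rw [Set.uIoc_of_le hσ] at hx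
    simpa using hb (x + φ T * I) (by simpa using hx.1.le) (by simpa using hx.2)
  have hbot := horiz (fun T => -T) (tendsto_neg_atTop_atBot.mono_right atBot_le_cocompact)
  have htop := horiz (fun T => T) (tendsto_id.mono_right atTop_le_cocompact)
  have rect : ∀ T : ℝ, (∫ x in σ₀..σ₁, G (x + (-T : ℝ) * I)) - (∫ x in σ₀..σ₁, G (x + T * I)) +
      I * (∫ y in (-T)..T, G (σ₁ + y * I)) - I * (∫ y in (-T)..T, G (σ₀ + y * I)) = 0 := by
    intro T
    have := integral_boundary_rect_eq_zero_of_differentiableOn G (σ₀ + (-T : ℝ) * I) (σ₁ + T * I)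
      (fun s hs => by
        have h1 := hs.1
        simp only [Set.mem_preimage, add_re, ofReal_re, mul_re, I_re, mul_zero, ofReal_im, I_im,
          mul_one, sub_self, add_zero, Set.uIcc_of_le hσ] at h1
        exact (hd s h1.1 h1.2).differentiableWithinAt)
    simpa using this
  have lim := ((hbot.sub htop).add (t1.const_mul I)).sub (t0.const_mul I)
  simp only [rect] at lim
  have := tendsto_nhds_unique lim tendsto_const_nhds
  have h2 : I * ((∫ t : ℝ, G (σ₁ + t * I)) - ∫ t : ℝ, G (σ₀ + t * I)) = 0 := by
    linear_combination this
  exact (sub_eq_zero.mp ((mul_eq_zero.mp h2).resolve_left I_ne_zero)).symm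

end VerticalLines

/-! ### Convergence of the Riesz sum and the Mellin transform of its derivative. -/

section RieszSums

open Complex MeasureTheory

/-- The coefficients of the derivative of the Riesz sum. -/
noncomputable def rieszCoeff {q : ℕ} (χ : DirichletCharacter ℂ q) (k ℓ : ℝ) (n : ℕ) : ℂ :=
  twistedMoebius χ n * ((n : ℝ) ^ (-(k + ℓ)) : ℝ)

/-- The negative of the derivative of the Riesz sum. -/
noncomputable def rieszDeriv {q : ℕ} (χ : DirichletCharacter ℂ q) (k ℓ x : ℝ) : ℂ :=
  ∑' n, rieszCoeff χ k ℓ n * (Real.exp (-(n : ℝ) ^ (-ℓ) * x) : ℝ)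

variable {q : ℕ} {χ : DirichletCharacter ℂ q} {k ℓ : ℝ}

lemma rieszCoeff_zero : rieszCoeff χ k ℓ 0 = 0 := by simp [rieszCoeff, twistedMoebius]

lemma norm_rieszCoeff_le (n : ℕ) : ‖rieszCoeff χ k ℓ n‖ ≤ (n : ℝ) ^ (-(k + ℓ)) := by
  have h : (0 : ℝ) ≤ (n : ℝ) ^ (-(k + ℓ)) := by positivity
  rw [rieszCoeff, norm_mul, norm_real, Real.norm_of_nonneg h]
  exact mul_le_of_le_one_left h (norm_twistedMoebius_le χ n)

lemma summable_norm_rieszCoeff (hk : 1 ≤ k) (hℓ : 0 < ℓ) :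
    Summable fun n => ‖rieszCoeff χ k ℓ n‖ :=
  Summable.of_nonneg_of_le (fun _ => norm_nonneg _) norm_rieszCoeff_le
    (Real.summable_nat_rpow.mpr (by linarith))

lemma norm_rieszDeriv_term_le {x : ℝ} (hx : 0 ≤ x) (n : ℕ) :
    ‖rieszCoeff χ k ℓ n * (Real.exp (-(n : ℝ) ^ (-ℓ) * x) : ℝ)‖ ≤ ‖rieszCoeff χ k ℓ n‖ := by
  rw [norm_mul, norm_real, Real.norm_of_nonneg (Real.exp_pos _).le]
  refine mul_le_of_le_one_right (norm_nonneg _) (Real.exp_le_one_iff.mpr ?_)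
  have : (0 : ℝ) ≤ (n : ℝ) ^ (-ℓ) := by positivity
  nlinarith

lemma hasSum_rieszDeriv (hk : 1 ≤ k) (hℓ : 0 < ℓ) {x : ℝ} (hx : 0 ≤ x) :
    HasSum (fun n => rieszCoeff χ k ℓ n * (Real.exp (-(n : ℝ) ^ (-ℓ) * x) : ℝ))
      (rieszDeriv χ k ℓ x) :=
  (Summable.of_norm_bounded (summable_norm_rieszCoeff hk hℓ)
    (norm_rieszDeriv_term_le hx)).hasSum

lemma continuousOn_rieszDeriv (hk : 1 ≤ k) (hℓ : 0 < ℓ) :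
    ContinuousOn (rieszDeriv χ k ℓ) (Set.Ici 0) := by
  unfold rieszDeriv
  exact continuousOn_tsum (fun n => by fun_prop) (summable_norm_rieszCoeff hk hℓ)
    fun n x hx => norm_rieszDeriv_term_le hx n

/-- Insert e^(-u) ≤ u^(-b) termwise; the remaining series converges because k + ℓ(1-b) > 1. This
unconditional decay yields the initial Mellin strip 0 < Re s < 1. -/
lemma exists_norm_rieszDeriv_le (hk : 1 ≤ k) (hℓ : 0 < ℓ) {b : ℝ} (hb0 : 0 ≤ b) (hb1 : b < 1) :
    ∃ C : ℝ, 0 ≤ C ∧ ∀ x : ℝ, 0 < x → ‖rieszDeriv χ k ℓ x‖ ≤ C * x ^ (-b) := by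
  have hs : Summable fun n : ℕ => (n : ℝ) ^ (-(k + ℓ) + ℓ * b) :=
    Real.summable_nat_rpow.mpr (by nlinarith)
  refine ⟨∑' n : ℕ, (n : ℝ) ^ (-(k + ℓ) + ℓ * b), tsum_nonneg fun n => by positivity,
    fun x hx => ?_⟩
  refine tsum_of_norm_bounded (hs.hasSum.mul_right _) fun n => ?_
  rcases Nat.eq_zero_or_pos n with rfl | hn
  · rw [rieszCoeff_zero, zero_mul, norm_zero]; positivity
  have hn' : (0 : ℝ) < n := by exact_mod_cast hn
  have hexp : ∀ u : ℝ, 0 < u → Real.exp (-u) ≤ u ^ (-b) := by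
    intro u hu
    rw [Real.exp_neg, Real.rpow_neg hu.le]
    refine inv_anti₀ (by positivity) ?_
    calc u ^ b ≤ (Real.exp u) ^ b := by
          gcongr; linarith [Real.add_one_le_exp u]
      _ = Real.exp (u * b) := (Real.exp_mul u b).symm
      _ ≤ Real.exp u := Real.exp_le_exp.mpr (by nlinarith)
  rw [norm_mul, norm_real, Real.norm_of_nonneg (Real.exp_pos _).le, neg_mul]
  calc ‖rieszCoeff χ k ℓ n‖ * Real.exp (-((n : ℝ) ^ (-ℓ) * x))
      ≤ (n : ℝ) ^ (-(k + ℓ)) * ((n : ℝ) ^ (-ℓ) * x) ^ (-b) := by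
        gcongr
        · exact norm_rieszCoeff_le n
        · exact hexp _ (by positivity)
    _ = _ := by
        rw [Real.mul_rpow (by positivity) hx.le, ← Real.rpow_mul hn'.le, ← mul_assoc,
          ← Real.rpow_add hn']
        ring_nf

lemma intervalIntegrable_rieszDeriv (hk : 1 ≤ k) (hℓ : 0 < ℓ) {x : ℝ} (hx : 0 ≤ x) :
    IntervalIntegrable (rieszDeriv χ k ℓ) volume 0 x :=
  ((continuousOn_rieszDeriv hk hℓ).mono (by
    rw [Set.uIcc_of_le hx]; exact Set.Icc_subset_Ici_self)).intervalIntegrable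

lemma hasSum_integral_rieszDeriv (hk : 1 ≤ k) (hℓ : 0 < ℓ) {x : ℝ} (hx : 0 ≤ x) :
    HasSum (fun n => ∫ t in (0 : ℝ)..x,
      rieszCoeff χ k ℓ n * (Real.exp (-(n : ℝ) ^ (-ℓ) * t) : ℝ))
      (∫ t in (0 : ℝ)..x, rieszDeriv χ k ℓ t) := by
  refine intervalIntegral.hasSum_integral_of_dominated_convergence
    (fun n _ => ‖rieszCoeff χ k ℓ n‖) (fun n => ?_) (fun n => .of_forall fun t ht => ?_)
    (.of_forall fun t _ => summable_norm_rieszCoeff hk hℓ) ?_ (.of_forall fun t ht => ?_)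
  · exact (Continuous.aestronglyMeasurable (by fun_prop))
  · rw [Set.uIoc_of_le hx] at ht
    exact norm_rieszDeriv_term_le ht.1.le n
  · exact intervalIntegrable_const
  · rw [Set.uIoc_of_le hx] at ht
    exact hasSum_rieszDeriv hk hℓ ht.1.le

lemma integral_rieszDeriv_term {n : ℕ} (hn : 0 < n) (x : ℝ) :
    ∫ t in (0 : ℝ)..x, rieszCoeff χ k ℓ n * (Real.exp (-(n : ℝ) ^ (-ℓ) * t) : ℝ) =
      twistedMoebius χ n / ((n : ℝ) ^ k : ℝ) -
        twistedMoebius χ n / ((n : ℝ) ^ k : ℝ) * (Real.exp (-x / (n : ℝ) ^ ℓ) : ℝ) := by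
  have hn' : (0 : ℝ) < n := by exact_mod_cast hn
  set p : ℝ := (n : ℝ) ^ (-ℓ) with hp
  have hp0 : 0 < p := by positivity
  have h1 : ∫ t in (0 : ℝ)..x, Real.exp (-p * t) = p⁻¹ * (1 - Real.exp (-p * x)) := by
    have hd : ∀ t ∈ Set.uIcc 0 x, HasDerivAt (fun t => -p⁻¹ * Real.exp (-p * t))
        (Real.exp (-p * t)) t := by
      intro t _
      have := (((hasDerivAt_id t).const_mul (-p)).exp).const_mul (-p⁻¹)
      refine this.congr_deriv ?_
      simp only [id]
      field_simp
    rw [intervalIntegral.integral_eq_sub_of_hasDerivAt hd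
      (Continuous.intervalIntegrable (by fun_prop) _ _)]
    simp
    ring
  have h2 : Real.exp (-x / (n : ℝ) ^ ℓ) = Real.exp (-p * x) := by
    rw [hp, Real.rpow_neg hn'.le]; congr 1; field_simp
  have h3 : (n : ℝ) ^ (-(k + ℓ)) * p⁻¹ = ((n : ℝ) ^ k)⁻¹ := by
    rw [hp, ← Real.rpow_neg hn'.le, ← Real.rpow_add hn', ← Real.rpow_neg hn'.le]; ring_nf
  rw [intervalIntegral.integral_const_mul, intervalIntegral.integral_ofReal, h1, h2, rieszCoeff,
    mul_assoc, ← ofReal_mul, ← mul_assoc, h3]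
  push_cast
  ring

/-- Only k = 1 uses the Tauberian theorem; for k > 1 the series converges absolutely. -/
lemma tendsto_sum_twistedMoebius_div_rpow {q : ℕ} [NeZero q] {χ : DirichletCharacter ℂ q}
    (hχ : χ.IsPrimitive) (hk : 1 ≤ k) :
    Tendsto (fun N : ℕ => ∑ n ∈ Finset.Icc 1 N, twistedMoebius χ n / ((n : ℝ) ^ k : ℝ)) atTop
      (𝓝 (invL χ k)) := by
  rcases hk.eq_or_lt with rfl | hk
  · simpa using tendsto_sum_twistedMoebius_div hχ
  have hk' : 1 < (k : ℂ).re := by simpa using hk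
  have hs : LSeriesSummable (twistedMoebius χ) k :=
    LSeriesSummable_of_bounded_of_one_lt_re (fun n _ => norm_twistedMoebius_le χ n) hk'
  rw [invL_eq_LSeries hχ hk']
  refine ((hs.hasSum.tendsto_sum_nat).comp (tendsto_add_atTop_nat 1)).congr fun N => ?_
  have : Finset.range (N + 1) = insert 0 (Finset.Icc 1 N) := by
    ext k; simp only [Finset.mem_range, Finset.mem_insert, Finset.mem_Icc]; omega
  simp only [Function.comp]
  rw [this, Finset.sum_insert (by simp), LSeries.term_zero, zero_add]
  refine Finset.sum_congr rfl fun n hn => ?_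
  have hn0 : n ≠ 0 := by have := (Finset.mem_Icc.mp hn).1; omega
  rw [LSeries.term_of_ne_zero hn0, ofReal_cpow (by positivity)]
  simp

/-- Convergence of the Riesz sum, with an integral formula for its value. -/
theorem tendsto_rieszPartialSum {q : ℕ} [NeZero q] {χ : DirichletCharacter ℂ q}
    (hχ : χ.IsPrimitive) (hk : 1 ≤ k) (hℓ : 0 < ℓ) {x : ℝ} (hx : 0 ≤ x) :
    Tendsto (rieszPartialSum χ k ℓ x) atTop
      (𝓝 (invL χ k - ∫ t in (0 : ℝ)..x, rieszDeriv χ k ℓ t)) := by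
  -- Each term is its value at x = 0 minus an integral. Conditional convergence is thereby confined
  -- to the series at x = 0.
  have h2 := ((hasSum_integral_rieszDeriv (χ := χ) hk hℓ hx).tendsto_sum_nat).comp
    (tendsto_add_atTop_nat 1)
  refine ((tendsto_sum_twistedMoebius_div_rpow hχ hk).sub h2).congr fun N => ?_
  have : Finset.range (N + 1) = insert 0 (Finset.Icc 1 N) := by
    ext k; simp only [Finset.mem_range, Finset.mem_insert, Finset.mem_Icc]; omega
  simp only [Function.comp]
  rw [this, Finset.sum_insert (by simp), rieszCoeff_zero]
  simp only [zero_mul, intervalIntegral.integral_zero, zero_add]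
  rw [← Finset.sum_sub_distrib, rieszPartialSum]
  refine Finset.sum_congr rfl fun n hn => ?_
  rw [integral_rieszDeriv_term (Finset.mem_Icc.mp hn).1, sub_sub_cancel, twistedMoebius]

lemma rieszSum_eq {q : ℕ} [NeZero q] {χ : DirichletCharacter ℂ q}
    (hχ : χ.IsPrimitive) (hk : 1 ≤ k) (hℓ : 0 < ℓ) {x : ℝ} (hx : 0 ≤ x) :
    rieszSum χ k ℓ x = invL χ k - ∫ t in (0 : ℝ)..x, rieszDeriv χ k ℓ t :=
  (tendsto_rieszPartialSum hχ hk hℓ hx).limUnder_eq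

/-- Termwise, exp(-n^(-ℓ)x) has Mellin transform Γ(s)n^(ℓs). The condition Re s < 1 puts k+ℓ-ℓs in
the half-plane of absolute convergence. -/
lemma mellin_rieszDeriv {q : ℕ} [NeZero q] {χ : DirichletCharacter ℂ q}
    (hχ : χ.IsPrimitive) (hk : 1 ≤ k) (hℓ : 0 < ℓ) {s : ℂ} (hs0 : 0 < s.re) (hs1 : s.re < 1) :
    mellin (rieszDeriv χ k ℓ) s = Gamma s * invL χ (k + ℓ - ℓ * s) := by
  have hw : 1 < ((k : ℂ) + ℓ - ℓ * s).re := by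
    simp only [sub_re, add_re, ofReal_re, re_ofReal_mul]; nlinarith
  have hp : ∀ n : ℕ, rieszCoeff χ k ℓ n = 0 ∨ 0 < (n : ℝ) ^ (-ℓ) := by
    intro n
    rcases Nat.eq_zero_or_pos n with rfl | hn
    · exact Or.inl rieszCoeff_zero
    · exact Or.inr (Real.rpow_pos_of_pos (by exact_mod_cast hn) _)
  have hterm : ∀ n : ℕ, Gamma s * rieszCoeff χ k ℓ n / (((n : ℝ) ^ (-ℓ) : ℝ) : ℂ) ^ s =
      Gamma s * LSeries.term (twistedMoebius χ) (k + ℓ - ℓ * s) n := by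
    intro n
    rcases Nat.eq_zero_or_pos n with rfl | hn
    · rw [rieszCoeff_zero, LSeries.term_zero]; simp
    have hn0 : (n : ℂ) ≠ 0 := by exact_mod_cast hn.ne'
    have hn' : (0 : ℝ) ≤ n := by positivity
    have e : (((n : ℝ) ^ (-ℓ) : ℝ) : ℂ) ^ s = (n : ℂ) ^ (-(ℓ : ℂ) * s) := by
      rw [← cpow_mul_ofReal_nonneg hn']; simp
    rw [mul_div_assoc, LSeries.term_of_ne_zero hn.ne', rieszCoeff, e, ofReal_cpow hn']
    push_cast
    rw [mul_div_assoc, ← cpow_sub _ _ hn0, div_eq_mul_inv (twistedMoebius χ n), ← cpow_neg]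
    congr 3
    ring
  have h := hasSum_mellin (F := rieszDeriv χ k ℓ) hp hs0
    (fun t ht => hasSum_rieszDeriv hk hℓ (le_of_lt ht)) (by
      refine Summable.of_nonneg_of_le (fun n => by positivity) (fun n => ?_)
        (Real.summable_nat_rpow.mpr (by nlinarith : -(k + ℓ) + ℓ * s.re < -1))
      rcases Nat.eq_zero_or_pos n with rfl | hn
      · rw [rieszCoeff_zero]; simp; positivity
      have hn' : (0 : ℝ) < n := by exact_mod_cast hn
      rw [Real.rpow_add hn', ← Real.rpow_mul hn'.le, neg_mul, Real.rpow_neg hn'.le (ℓ * s.re),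
        div_inv_eq_mul]
      gcongr
      exact norm_rieszCoeff_le n)
  simp only [hterm] at h
  rw [← h.tsum_eq, tsum_mul_left, invL_eq_LSeries hχ hw, LSeries]

end RieszSums

/-! ### Zero-free half-plane implies decay of the Riesz sum. -/

section ZeroFreeImpliesDecay

open Complex MeasureTheory

variable {q : ℕ} [NeZero q] {χ : DirichletCharacter ℂ q} {k ℓ : ℝ}

lemma locallyIntegrableOn_rieszDeriv {q : ℕ} {χ : DirichletCharacter ℂ q} {k ℓ : ℝ}
    (hk : 1 ≤ k) (hℓ : 0 < ℓ) :
    LocallyIntegrableOn (rieszDeriv χ k ℓ) (Set.Ioi 0) :=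
  ((continuousOn_rieszDeriv hk hℓ).mono Set.Ioi_subset_Ici_self).locallyIntegrableOn
    measurableSet_Ioi

lemma isBigO_rieszDeriv_zero {q : ℕ} {χ : DirichletCharacter ℂ q} {k ℓ : ℝ}
    (hk : 1 ≤ k) (hℓ : 0 < ℓ) :
    rieszDeriv χ k ℓ =O[𝓝[>] 0] fun x : ℝ => x ^ (-0 : ℝ) := by
  obtain ⟨C, -, hC⟩ := exists_norm_rieszDeriv_le (χ := χ) hk hℓ le_rfl zero_lt_one
  refine IsBigO.of_bound C ?_
  filter_upwards [self_mem_nhdsWithin] with x hx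
  have hx : 0 < x := hx
  rw [Real.norm_of_nonneg (by positivity)]
  exact hC x hx

lemma mellinConvergent_rieszDeriv {q : ℕ} {χ : DirichletCharacter ℂ q} {k ℓ : ℝ}
    (hk : 1 ≤ k) (hℓ : 0 < ℓ) {s : ℂ} (hs0 : 0 < s.re) (hs1 : s.re < 1) :
    MellinConvergent (rieszDeriv χ k ℓ) s := by
  obtain ⟨b, hb0, hb1⟩ := exists_between hs1
  obtain ⟨C, -, hC⟩ := exists_norm_rieszDeriv_le (χ := χ) hk hℓ (hs0.trans hb0).le hb1
  refine mellinConvergent_of_isBigO_rpow (locallyIntegrableOn_rieszDeriv hk hℓ) (a := b)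
    (IsBigO.of_bound C ?_) hb0 (isBigO_rieszDeriv_zero hk hℓ) hs0
  filter_upwards [eventually_gt_atTop 0] with x hx
  rw [Real.norm_of_nonneg (by positivity)]
  exact hC x hx

/-- The Mellin transform of `rieszDeriv`. -/
noncomputable def rieszMellin (χ : DirichletCharacter ℂ q) (k ℓ : ℝ) (s : ℂ) : ℂ :=
  Gamma s * invL χ (k + ℓ - ℓ * s)

lemma differentiableAt_rieszMellin (hχ : χ.IsPrimitive)
    (hne : ∀ w : ℂ, 1 / 2 < w.re → entireL χ w ≠ 0) {s : ℂ} (hs0 : 0 < s.re)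
    (hs1 : 1 / 2 < k + ℓ - ℓ * s.re) : DifferentiableAt ℂ (rieszMellin χ k ℓ) s := by
  have h1 : DifferentiableAt ℂ (invL χ) (k + ℓ - ℓ * s) := by
    refine differentiableAt_invL hχ (hne _ ?_)
    simpa using hs1
  have h2 : DifferentiableAt ℂ Gamma s := differentiableAt_Gamma s fun m h => by
    rw [h] at hs0
    have : (0 : ℝ) ≤ m := by positivity
    simp at hs0
    linarith
  exact h2.mul (DifferentiableAt.comp (g := invL χ) s h1 (by fun_prop))

lemma exists_norm_rieszMellin_le (hχ : χ.IsPrimitive) (hℓ : 0 < ℓ)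
    (hne : ∀ w : ℂ, 1 / 2 < w.re → entireL χ w ≠ 0) {σ₀ σ₁ : ℝ} (hσ₀ : 0 < σ₀)
    (hσ₁ : 1 / 2 < k + ℓ - ℓ * σ₁) :
    ∃ C : ℝ, ∀ s : ℂ, σ₀ ≤ s.re → s.re ≤ σ₁ →
      ‖rieszMellin χ k ℓ s‖ ≤ C * (1 + s.im ^ 2)⁻¹ := by
  obtain ⟨C, A, hC0, hC⟩ := exists_norm_invL_le hχ hne (sub_pos.mpr hσ₁)
  -- A powers absorb the growth of 1/L; the other two leave quadratic decay.
  obtain ⟨D, hD0, hD⟩ := exists_norm_Gamma_mul_pow_le σ₁ hσ₀ (A + 2)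
  refine ⟨D * (C * (1 + ℓ) ^ A), fun s h0 h1 => ?_⟩
  have hw := hC (k + ℓ - ℓ * s) (by
    simp only [sub_re, add_re, ofReal_re, re_ofReal_mul]; nlinarith)
  have him : ((k : ℂ) + ℓ - ℓ * s).im = -(ℓ * s.im) := by simp
  rw [him, abs_neg, abs_mul, abs_of_pos hℓ] at hw
  have ht := abs_nonneg s.im
  have h2 : (1 + ℓ * |s.im|) ^ A ≤ (1 + ℓ) ^ A * (1 + |s.im|) ^ A := by
    rw [← mul_pow]
    gcongr
    nlinarith
  have h3 : 1 + s.im ^ 2 ≤ (1 + |s.im|) ^ 2 := by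
    rw [← sq_abs s.im]; nlinarith
  rw [← div_eq_mul_inv, le_div_iff₀ (by positivity), rieszMellin, norm_mul]
  calc ‖Gamma s‖ * ‖invL χ (k + ℓ - ℓ * s)‖ * (1 + s.im ^ 2)
      ≤ ‖Gamma s‖ * (C * ((1 + ℓ) ^ A * (1 + |s.im|) ^ A)) * (1 + |s.im|) ^ 2 := by
        gcongr
        exact hw.trans (by gcongr)
    _ = ‖Gamma s‖ * (1 + |s.im|) ^ (A + 2) * (C * (1 + ℓ) ^ A) := by ring
    _ ≤ D * (C * (1 + ℓ) ^ A) := by gcongr; exact hD s h0 h1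

/-- Mellin inversion on Re s = 1/2, followed by a shift to Re s = 1+a. On the new line the argument
of 1/L has real part k-ℓa > 1/2, so no singularity is crossed. -/
lemma exists_norm_rieszDeriv_le_of_ne_zero (hχ : χ.IsPrimitive) (hk : 1 ≤ k) (hℓ : 0 < ℓ)
    (hne : ∀ w : ℂ, 1 / 2 < w.re → entireL χ w ≠ 0) {a : ℝ} (ha : 0 < a)
    (hka : 1 / 2 < k - ℓ * a) :
    ∃ C : ℝ, ∀ x : ℝ, 0 < x → ‖rieszDeriv χ k ℓ x‖ ≤ C * x ^ (-(1 + a)) := by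
  obtain ⟨C, hC⟩ := exists_norm_rieszMellin_le (k := k) (σ₁ := 1 + a) hχ hℓ hne one_half_pos
    (by linarith)
  have hdiff : ∀ s : ℂ, 1 / 2 ≤ s.re → s.re ≤ 1 + a →
      DifferentiableAt ℂ (rieszMellin χ k ℓ) s := fun s h0 h1 =>
    differentiableAt_rieszMellin hχ hne (by linarith) (by nlinarith)
  refine ⟨1 / (2 * Real.pi) * ∫ t : ℝ, C * (1 + t ^ 2)⁻¹, fun x hx => ?_⟩
  have hx0 : (x : ℂ) ≠ 0 := by exact_mod_cast hx.ne'
  have hmel : ∀ t : ℝ, mellin (rieszDeriv χ k ℓ) (((1 / 2 : ℝ) : ℂ) + t * I) =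
      rieszMellin χ k ℓ (((1 / 2 : ℝ) : ℂ) + t * I) := fun t =>
    mellin_rieszDeriv hχ hk hℓ (by simp) (by simp; norm_num)
  have hinv := mellinInv_mellin_eq (1 / 2) (rieszDeriv χ k ℓ) hx
    (mellinConvergent_rieszDeriv hk hℓ (by simp) (by simp; norm_num))
    (by
      unfold VerticalIntegrable
      simp only [hmel]
      exact integrable_vertical (C := C)
        (fun s hs => (hdiff s hs.ge (by linarith)).continuousAt)
        (fun s hs => hC s hs.ge (by linarith)))
    ((continuousOn_rieszDeriv hk hℓ).continuousAt (Ici_mem_nhds hx))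
  set G : ℂ → ℂ := fun s => (x : ℂ) ^ (-s) * rieszMellin χ k ℓ s with hG
  have hxs : ∃ X : ℝ, ∀ s : ℂ, 1 / 2 ≤ s.re → s.re ≤ 1 + a → ‖(x : ℂ) ^ (-s)‖ ≤ X := by
    have hc : ContinuousOn (fun σ : ℝ => x ^ (-σ)) (Set.Icc (1 / 2) (1 + a)) :=
      (continuous_const.rpow continuous_neg fun _ => .inl hx.ne').continuousOn
    obtain ⟨X, hX⟩ := isCompact_Icc.bddAbove_image hc
    refine ⟨X, fun s h0 h1 => ?_⟩
    rw [norm_cpow_eq_rpow_re_of_pos hx, neg_re]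
    exact hX ⟨s.re, ⟨h0, h1⟩, rfl⟩
  obtain ⟨X, hX⟩ := hxs
  have hshift := integral_vertical_eq (G := G) (σ₀ := 1 / 2) (σ₁ := 1 + a) (C := X * C)
    (by linarith)
    (fun s h0 h1 => by
      have := hdiff s h0 h1
      exact (DifferentiableAt.const_cpow (by fun_prop) (.inl hx0)).mul this)
    (fun s h0 h1 => by
      rw [hG, norm_mul, mul_assoc]
      exact mul_le_mul (hX s h0 h1) (hC s h0 h1) (norm_nonneg _)
        ((norm_nonneg _).trans (hX s h0 h1)))
  have hQ : rieszDeriv χ k ℓ x =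
      (1 / (2 * Real.pi) : ℝ) • ∫ t : ℝ, G (((1 + a : ℝ) : ℂ) + t * I) := by
    rw [← hshift, ← hinv, mellinInv]
    simp only [hmel, hG, smul_eq_mul]
  rw [hQ, norm_smul, Real.norm_of_nonneg (by positivity), mul_assoc]
  gcongr
  rw [← integral_mul_const]
  refine norm_integral_le_of_norm_le
    ((integrable_inv_one_add_sq.const_mul C).mul_const _) (.of_forall fun t => ?_)
  have h1 := hC (((1 + a : ℝ) : ℂ) + t * I) (by simp; linarith) (by simp)
  rw [hG, norm_mul, norm_cpow_eq_rpow_re_of_pos hx, mul_comm]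
  have h2 : (-(((1 + a : ℝ) : ℂ) + t * I)).re = -(1 + a) := by simp
  have h3 : (((1 + a : ℝ) : ℂ) + t * I).im = t := by simp
  rw [h2]
  rw [h3] at h1
  gcongr

/-- The integral is the Mellin transform at s = 1, on the edge of the strip where the formula is
known. The improved decay makes both sides continuous there, so the formula passes to the limit σ →
1 from below. -/
lemma integral_rieszDeriv_eq (hχ : χ.IsPrimitive) (hk : 1 ≤ k) (hℓ : 0 < ℓ)
    (hne : ∀ w : ℂ, 1 / 2 < w.re → entireL χ w ≠ 0) {a C : ℝ} (ha : 0 < a)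
    (hC : ∀ x : ℝ, 0 < x → ‖rieszDeriv χ k ℓ x‖ ≤ C * x ^ (-(1 + a))) :
    ∫ x in Set.Ioi 0, rieszDeriv χ k ℓ x = invL χ k := by
  have hm : DifferentiableAt ℂ (mellin (rieszDeriv χ k ℓ)) 1 := by
    refine mellin_differentiableAt_of_isBigO_rpow (a := 1 + a)
      (locallyIntegrableOn_rieszDeriv hk hℓ) (IsBigO.of_bound C ?_) (by simpa using ha)
      (isBigO_rieszDeriv_zero hk hℓ) (by simp)
    filter_upwards [eventually_gt_atTop 0] with x hx
    rw [Real.norm_of_nonneg (by positivity)]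
    exact hC x hx
  have hF : DifferentiableAt ℂ (rieszMellin χ k ℓ) 1 :=
    differentiableAt_rieszMellin hχ hne (by simp) (by simp; linarith)
  have hcast : Tendsto (fun σ : ℝ => (σ : ℂ)) (𝓝[<] 1) (𝓝 1) :=
    (continuous_ofReal.tendsto' 1 1 (by simp)).mono_left nhdsWithin_le_nhds
  have h1 := hm.continuousAt.tendsto.comp hcast
  have h2 := hF.continuousAt.tendsto.comp hcast
  have heq : mellin (rieszDeriv χ k ℓ) 1 = rieszMellin χ k ℓ 1 := by
    refine tendsto_nhds_unique (h1.congr' ?_) h2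
    filter_upwards [Ioo_mem_nhdsLT (zero_lt_one (α := ℝ))] with σ hσ
    exact mellin_rieszDeriv hχ hk hℓ (by simpa using hσ.1) (by simpa using hσ.2)
  simpa [mellin, rieszMellin] using heq

/-- If `L(w, χ)` has no zeros in `Re w > 1 / 2`, the Riesz sum is `O(x ^ (-a))` for every
`a > 0` with `k - ℓ a > 1 / 2`. -/
theorem exists_norm_rieszSum_le_of_ne_zero (hχ : χ.IsPrimitive) (hk : 1 ≤ k) (hℓ : 0 < ℓ)
    (hne : ∀ w : ℂ, 1 / 2 < w.re → entireL χ w ≠ 0) {a : ℝ} (ha : 0 < a)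
    (hka : 1 / 2 < k - ℓ * a) :
    ∃ C : ℝ, ∀ x : ℝ, 0 < x → ‖rieszSum χ k ℓ x‖ ≤ C * x ^ (-a) := by
  obtain ⟨C, hC⟩ := exists_norm_rieszDeriv_le_of_ne_zero hχ hk hℓ hne ha hka
  have hint := integral_rieszDeriv_eq hχ hk hℓ hne ha hC
  refine ⟨C / a, fun x hx => ?_⟩
  have hpow : IntegrableOn (fun t : ℝ => C * t ^ (-(1 + a))) (Set.Ioi x) :=
    (integrableOn_Ioi_rpow_of_lt (by linarith) hx).const_mul C
  have hbound : ∀ᵐ t ∂volume.restrict (Set.Ioi x),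
      ‖rieszDeriv χ k ℓ t‖ ≤ C * t ^ (-(1 + a)) := by
    filter_upwards [ae_restrict_mem measurableSet_Ioi] with t ht
    exact hC t (hx.trans ht)
  have hQx : IntegrableOn (rieszDeriv χ k ℓ) (Set.Ioi x) := by
    refine Integrable.mono' hpow ?_ hbound
    refine ContinuousOn.aestronglyMeasurable ?_ measurableSet_Ioi
    exact (continuousOn_rieszDeriv hk hℓ).mono fun t ht => (hx.trans ht).le
  have hQ0 := intervalIntegrable_rieszDeriv (χ := χ) hk hℓ hx.le
  have hsplit : ∫ t in Set.Ioi 0, rieszDeriv χ k ℓ t =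
      (∫ t in (0 : ℝ)..x, rieszDeriv χ k ℓ t) + ∫ t in Set.Ioi x, rieszDeriv χ k ℓ t := by
    rw [intervalIntegral.integral_of_le hx.le, ← setIntegral_union
      (Set.Ioc_disjoint_Ioi le_rfl) measurableSet_Ioi
      ((intervalIntegrable_iff_integrableOn_Ioc_of_le hx.le).mp hQ0) hQx,
      Set.Ioc_union_Ioi_eq_Ioi hx.le]
  have e : rieszSum χ k ℓ x = ∫ t in Set.Ioi x, rieszDeriv χ k ℓ t := by
    rw [rieszSum_eq hχ hk hℓ hx.le, ← hint, hsplit]; ring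
  rw [e]
  refine (norm_integral_le_of_norm_le hpow hbound).trans_eq ?_
  rw [integral_const_mul, integral_Ioi_rpow_of_lt (by linarith) hx]
  have : -(1 + a) + 1 = -a := by ring
  rw [this]
  field_simp

end ZeroFreeImpliesDecay

/-! ### Decay of the Riesz sum excludes zeros. -/

section DecayImpliesZeroFree

open Complex MeasureTheory

variable {q : ℕ} [NeZero q] {χ : DirichletCharacter ℂ q} {k ℓ : ℝ}

/-- The Riesz sum, modified by an exponential so as to vanish at `0`. -/
noncomputable def rieszRemainder (χ : DirichletCharacter ℂ q) (k ℓ x : ℝ) : ℂ :=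
  rieszSum χ k ℓ x - invL χ k * (Real.exp (-x) : ℝ)

lemma hasDerivAt_rieszRemainder (hχ : χ.IsPrimitive) (hk : 1 ≤ k) (hℓ : 0 < ℓ) {x : ℝ}
    (hx : 0 < x) :
    HasDerivAt (rieszRemainder χ k ℓ)
      (-(rieszDeriv χ k ℓ x - invL χ k * (Real.exp (-x) : ℝ))) x := by
  have hc : ContinuousAt (rieszDeriv χ k ℓ) x :=
    (continuousOn_rieszDeriv hk hℓ).continuousAt (Ici_mem_nhds hx)
  have h1 : HasDerivAt (fun y => ∫ t in (0 : ℝ)..y, rieszDeriv χ k ℓ t)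
      (rieszDeriv χ k ℓ x) x :=
    intervalIntegral.integral_hasDerivAt_right (intervalIntegrable_rieszDeriv hk hℓ hx.le)
      (((continuousOn_rieszDeriv hk hℓ).mono Set.Ioi_subset_Ici_self).stronglyMeasurableAtFilter
        isOpen_Ioi x hx) hc
  have h2 : HasDerivAt (fun y : ℝ => ((Real.exp (-y) : ℝ) : ℂ)) ((-Real.exp (-x) : ℝ) : ℂ) x := by
    have := ((hasDerivAt_neg x).exp).ofReal_comp
    simpa using this
  have h3 := (h1.const_sub (invL χ k)).sub (h2.const_mul (invL χ k))
  refine (h3.congr_of_eventuallyEq ?_).congr_deriv (by push_cast; ring)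
  filter_upwards [Ioi_mem_nhds hx] with y hy
  have hy : 0 < y := hy
  simp only [Pi.sub_apply]
  rw [rieszRemainder, rieszSum_eq hχ hk hℓ hy.le]

/-- Linear vanishing at 0 moves the left edge of the Mellin strip to Re s = -1, providing the region
-1 < Re s < 0 in which the transform can be computed. -/
lemma exists_norm_rieszRemainder_le (hχ : χ.IsPrimitive) (hk : 1 ≤ k) (hℓ : 0 < ℓ) :
    ∃ C : ℝ, 0 ≤ C ∧ ∀ x : ℝ, 0 < x → ‖rieszRemainder χ k ℓ x‖ ≤ C * x := by
  obtain ⟨B, hB0, hB⟩ := exists_norm_rieszDeriv_le (χ := χ) hk hℓ le_rfl zero_lt_one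
  refine ⟨‖invL χ k‖ + B, by positivity, fun x hx => ?_⟩
  have h1 : ‖∫ t in (0 : ℝ)..x, rieszDeriv χ k ℓ t‖ ≤ B * x := by
    have := intervalIntegral.norm_integral_le_of_norm_le_const (a := 0) (b := x) (C := B)
      (f := rieszDeriv χ k ℓ) fun t ht => by
        rw [Set.uIoc_of_le hx.le] at ht
        simpa using hB t ht.1
    rwa [sub_zero, abs_of_pos hx] at this
  have h2 : ‖(1 - (Real.exp (-x) : ℝ) : ℂ)‖ ≤ x := by
    have : (1 - (Real.exp (-x) : ℝ) : ℂ) = ((1 - Real.exp (-x) : ℝ) : ℂ) := by push_cast; rfl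
    rw [this, norm_real, Real.norm_of_nonneg]
    · linarith [Real.add_one_le_exp (-x)]
    · linarith [Real.exp_le_one_iff.mpr (by linarith : -x ≤ 0)]
  have e : rieszRemainder χ k ℓ x = invL χ k * (1 - (Real.exp (-x) : ℝ)) -
      ∫ t in (0 : ℝ)..x, rieszDeriv χ k ℓ t := by
    rw [rieszRemainder, rieszSum_eq hχ hk hℓ hx.le]; ring
  rw [e, add_mul]
  refine (norm_sub_le _ _).trans (add_le_add ?_ h1)
  rw [norm_mul]
  gcongr

lemma isBigO_rieszRemainder_zero (hχ : χ.IsPrimitive) (hk : 1 ≤ k) (hℓ : 0 < ℓ) :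
    rieszRemainder χ k ℓ =O[𝓝[>] 0] fun x : ℝ => x ^ (-(-1) : ℝ) := by
  obtain ⟨C, -, hC⟩ := exists_norm_rieszRemainder_le hχ hk hℓ
  refine IsBigO.of_bound C ?_
  filter_upwards [self_mem_nhdsWithin] with x hx
  have hx : 0 < x := hx
  rw [neg_neg, Real.rpow_one, Real.norm_of_nonneg hx.le]
  exact hC x hx

lemma isBigO_rieszRemainder_atTop {a : ℝ}
    (h : (fun x => rieszSum χ k ℓ x) =O[atTop] fun x : ℝ => x ^ (-a)) :
    rieszRemainder χ k ℓ =O[atTop] fun x : ℝ => x ^ (-a) := by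
  refine h.sub (IsBigO.const_mul_left ?_ _)
  have : (fun x : ℝ => Real.exp (-x)) =O[atTop] fun x : ℝ => x ^ (-a) := by
    simpa using (isLittleO_exp_neg_mul_rpow_atTop one_pos (-a)).isBigO
  exact IsBigO.of_norm_left (this.norm_left.congr_left fun x => (norm_real _).symm)

lemma locallyIntegrableOn_rieszRemainder (hχ : χ.IsPrimitive) (hk : 1 ≤ k) (hℓ : 0 < ℓ) :
    LocallyIntegrableOn (rieszRemainder χ k ℓ) (Set.Ioi 0) :=
  ContinuousOn.locallyIntegrableOn (fun _ hx =>
    (hasDerivAt_rieszRemainder hχ hk hℓ hx).continuousAt.continuousWithinAt) measurableSet_Ioi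

/-- Integration by parts passes to the derivative at s+1, which lies in the strip of
`mellin_rieszDeriv`, and k+ℓ-ℓ(s+1) = k-ℓs. The boundary terms vanish by the O(x) bound at 0 and the
assumed decay at infinity. -/
lemma mul_mellin_rieszRemainder (hχ : χ.IsPrimitive) (hk : 1 ≤ k) (hℓ : 0 < ℓ) {a : ℝ}
    (ha : 0 ≤ a) (h : (fun x => rieszSum χ k ℓ x) =O[atTop] fun x : ℝ => x ^ (-a)) {s : ℂ}
    (hs0 : -1 < s.re) (hs1 : s.re < 0) :
    s * mellin (rieszRemainder χ k ℓ) s =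
      Gamma (s + 1) * invL χ (k - ℓ * s) - invL χ k * Gamma (s + 1) := by
  have hs1re : (s + 1).re = s.re + 1 := by simp
  have hne0 : s ≠ 0 := by rintro rfl; simp at hs1
  have hconv : MellinConvergent (rieszRemainder χ k ℓ) s :=
    mellinConvergent_of_isBigO_rpow (locallyIntegrableOn_rieszRemainder hχ hk hℓ)
      (isBigO_rieszRemainder_atTop h) (by linarith) (isBigO_rieszRemainder_zero hχ hk hℓ) hs0
  have hQ : MellinConvergent (rieszDeriv χ k ℓ) (s + 1) :=
    mellinConvergent_rieszDeriv hk hℓ (by rw [hs1re]; linarith) (by rw [hs1re]; linarith)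
  have hE : IntegrableOn (fun x : ℝ => ((Real.exp (-x) : ℝ) : ℂ) * (x : ℂ) ^ (s + 1 - 1))
      (Set.Ioi 0) := GammaIntegral_convergent (by rw [hs1re]; linarith)
  unfold MellinConvergent at hconv hQ
  rw [add_sub_cancel_right] at hQ hE
  simp only [smul_eq_mul] at hconv hQ
  have hu'v : IntegrableOn (fun x : ℝ => -(rieszDeriv χ k ℓ x - invL χ k * (Real.exp (-x) : ℝ)) *
      (x : ℂ) ^ s) (Set.Ioi 0) := by
    have := (hE.const_mul (invL χ k)).sub hQ
    refine IntegrableOn.congr_fun this (fun x _ => ?_) measurableSet_Ioi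
    simp only [Pi.sub_apply]
    ring
  have huv' : IntegrableOn (fun x : ℝ => rieszRemainder χ k ℓ x * (s * (x : ℂ) ^ (s - 1)))
      (Set.Ioi 0) := by
    refine IntegrableOn.congr_fun (hconv.const_mul s) (fun x _ => ?_) measurableSet_Ioi
    ring
  obtain ⟨C, hC0, hC⟩ := exists_norm_rieszRemainder_le hχ hk hℓ
  have hlim0 : Tendsto (rieszRemainder χ k ℓ * fun x : ℝ => (x : ℂ) ^ s) (𝓝[>] 0) (𝓝 0) := by
    have hz : Tendsto (fun x : ℝ => C * x ^ (s.re + 1)) (𝓝[>] 0) (𝓝 0) := by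
      have : ContinuousAt (fun x : ℝ => x ^ (s.re + 1)) 0 :=
        Real.continuousAt_rpow_const 0 _ (.inr (by linarith))
      have := (this.tendsto.mono_left (nhdsWithin_le_nhds (s := Set.Ioi 0))).const_mul C
      rwa [Real.zero_rpow (by linarith), mul_zero] at this
    refine squeeze_zero_norm' ?_ hz
    filter_upwards [self_mem_nhdsWithin] with x hx
    have hx : 0 < x := hx
    rw [Pi.mul_apply, norm_mul, norm_cpow_eq_rpow_re_of_pos hx, Real.rpow_add_one hx.ne',
      mul_comm (x ^ s.re), ← mul_assoc]
    gcongr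
    exact hC x hx
  have hlimTop : Tendsto (rieszRemainder χ k ℓ * fun x : ℝ => (x : ℂ) ^ s) atTop (𝓝 0) := by
    have h1 : (rieszRemainder χ k ℓ * fun x : ℝ => (x : ℂ) ^ s) =O[atTop]
        fun x : ℝ => x ^ (-a) * x ^ s.re := by
      refine (isBigO_rieszRemainder_atTop h).mul (IsBigO.of_bound 1 ?_)
      filter_upwards [eventually_gt_atTop 0] with x hx
      rw [norm_cpow_eq_rpow_re_of_pos hx, one_mul, Real.norm_of_nonneg (by positivity)]
    refine h1.trans_tendsto ?_
    refine (tendsto_rpow_neg_atTop (by linarith : 0 < a - s.re)).congr' ?_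
    filter_upwards [eventually_gt_atTop 0] with x hx
    rw [← Real.rpow_add hx]; ring_nf
  have parts := integral_Ioi_mul_deriv_eq_deriv_mul (a := 0)
    (u := rieszRemainder χ k ℓ) (v := fun x : ℝ => (x : ℂ) ^ s)
    (fun x hx => hasDerivAt_rieszRemainder hχ hk hℓ hx)
    (fun x hx => hasDerivAt_ofReal_cpow_const (ne_of_gt hx) hne0) huv' hu'v hlim0 hlimTop
  have hQm : ∫ x : ℝ in Set.Ioi 0, (x : ℂ) ^ s * rieszDeriv χ k ℓ x =
      Gamma (s + 1) * invL χ (k - ℓ * s) := by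
    have := mellin_rieszDeriv hχ hk hℓ (s := s + 1) (by rw [hs1re]; linarith)
      (by rw [hs1re]; linarith)
    rw [mellin, add_sub_cancel_right] at this
    simp only [smul_eq_mul] at this
    rw [this]
    ring_nf
  have hEm : ∫ x : ℝ in Set.Ioi 0, ((Real.exp (-x) : ℝ) : ℂ) * (x : ℂ) ^ s = Gamma (s + 1) := by
    rw [Gamma_eq_integral (by rw [hs1re]; linarith), GammaIntegral, add_sub_cancel_right]
  have hL : s * mellin (rieszRemainder χ k ℓ) s =
      ∫ x : ℝ in Set.Ioi 0, rieszRemainder χ k ℓ x * (s * (x : ℂ) ^ (s - 1)) := by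
    rw [mellin, ← integral_const_mul]
    refine integral_congr_ae (.of_forall fun x => ?_)
    simp only [smul_eq_mul]
    ring
  have hR : ∫ x : ℝ in Set.Ioi 0, -(rieszDeriv χ k ℓ x - invL χ k * (Real.exp (-x) : ℝ)) *
      (x : ℂ) ^ s = invL χ k * Gamma (s + 1) - Gamma (s + 1) * invL χ (k - ℓ * s) := by
    rw [← hQm, ← hEm, ← integral_const_mul, ← integral_sub (hE.const_mul _) hQ]
    refine integral_congr_ae (.of_forall fun x => ?_)
    simp only
    ring
  rw [hL, parts, hR]
  ring

/-- If the Riesz sum is `O(x ^ (-a))`, then `L(w, χ)` has no zeros other than possibly `w = 1` with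
`k - ℓ a < Re w < k + ℓ`. -/
theorem eq_one_of_entireL_eq_zero_of_isBigO (hχ : χ.IsPrimitive) (hk : 1 ≤ k) (hℓ : 0 < ℓ)
    {a : ℝ} (ha : 0 ≤ a) (h : (fun x => rieszSum χ k ℓ x) =O[atTop] fun x : ℝ => x ^ (-a))
    {w : ℂ} (hw0 : k - ℓ * a < w.re) (hw1 : w.re < k + ℓ) (hw : entireL χ w = 0) : w = 1 := by
  set U : Set ℂ := {s : ℂ | -1 < s.re ∧ s.re < a} with hU
  have hUo : IsOpen U :=
    (isOpen_lt continuous_const continuous_re).inter (isOpen_lt continuous_re continuous_const)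
  have hUc : IsPreconnected U :=
    ((convex_halfSpace_re_gt (-1)).inter (convex_halfSpace_re_lt a)).isPreconnected
  have hGamma : ∀ s : ℂ, -1 < s.re → DifferentiableAt ℂ (fun s => Gamma (s + 1)) s := by
    intro s hs
    refine (differentiableAt_Gamma (s + 1) fun m hm => ?_).comp s (by fun_prop)
    have h1 := congrArg re hm
    have : (0 : ℝ) ≤ m := by positivity
    simp at h1
    linarith
  have hlin : Differentiable ℂ fun s : ℂ => (k : ℂ) - ℓ * s := by fun_prop
  -- The identity is multiplied through by `entireL`, so that both sides are analytic on the whole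
  -- strip without knowledge of the zeros.
  have hf1 : AnalyticOnNhd ℂ (fun s => entireL χ (k - ℓ * s) *
      (s * mellin (rieszRemainder χ k ℓ) s + invL χ k * Gamma (s + 1))) U := by
    refine DifferentiableOn.analyticOnNhd (fun s hs =>
      DifferentiableAt.differentiableWithinAt ?_) hUo
    have h1 : DifferentiableAt ℂ (mellin (rieszRemainder χ k ℓ)) s :=
      mellin_differentiableAt_of_isBigO_rpow (locallyIntegrableOn_rieszRemainder hχ hk hℓ)
        (isBigO_rieszRemainder_atTop h) hs.2 (isBigO_rieszRemainder_zero hχ hk hℓ) hs.1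
    have h2 := hGamma s hs.1
    have h3 : DifferentiableAt ℂ (fun s : ℂ => entireL χ (k - ℓ * s)) s :=
      ((differentiable_entireL hχ).comp hlin) s
    exact h3.mul ((differentiableAt_id.mul h1).add (h2.const_mul _))
  have hf2 : AnalyticOnNhd ℂ (fun s => poleFactor q (k - ℓ * s) * Gamma (s + 1)) U := by
    refine DifferentiableOn.analyticOnNhd (fun s hs =>
      DifferentiableAt.differentiableWithinAt ?_) hUo
    exact (((differentiable_poleFactor q).comp hlin) s).mul (hGamma s hs.1)
  have hz₀ : (-1 / 2 : ℂ) ∈ U := by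
    constructor <;> norm_num
    linarith
  have heq := hf1.eqOn_of_preconnected_of_eventuallyEq hf2 hUc hz₀ (by
    have hV : {s : ℂ | -1 < s.re ∧ s.re < 0} ∈ 𝓝 (-1 / 2 : ℂ) :=
      ((isOpen_lt continuous_const continuous_re).inter
        (isOpen_lt continuous_re continuous_const)).mem_nhds (by constructor <;> norm_num)
    filter_upwards [hV] with s hs
    have h1 := mul_mellin_rieszRemainder hχ hk hℓ ha h hs.1 hs.2
    -- For Re s < 0 the argument has real part above k ≥ 1.
    have h2 : entireL χ (k - ℓ * s) ≠ 0 := by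
      refine entireL_ne_zero_of_one_le_re hχ ?_
      simp only [sub_re, ofReal_re, re_ofReal_mul]
      nlinarith [hs.2]
    rw [h1, sub_add_cancel, invL]
    field_simp)
  set s : ℂ := (k - w) / ℓ with hs
  have hℓ0 : (ℓ : ℂ) ≠ 0 := by exact_mod_cast hℓ.ne'
  have hsw : (k : ℂ) - ℓ * s = w := by rw [hs]; field_simp; ring
  have hsre : s.re = (k - w.re) / ℓ := by
    rw [hs, div_ofReal_re]; simp
  have hsU : s ∈ U := by
    constructor
    · rw [hsre, lt_div_iff₀ hℓ]; linarith
    · rw [hsre, div_lt_iff₀ hℓ]; linarith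
  have h1 := heq hsU
  simp only [hsw, hw, zero_mul] at h1
  have h2 : Gamma (s + 1) ≠ 0 := Gamma_ne_zero_of_re_pos (by
    have := hsU.1
    simp; linarith)
  by_contra hne
  exact mul_ne_zero (poleFactor_ne_zero hne) h2 h1.symm

end DecayImpliesZeroFree

/-! ### Symmetries of the nontrivial zeros. -/

section FunctionalEquation

open Complex DirichletCharacter ComplexConjugate

variable {q : ℕ} [NeZero q] {χ : DirichletCharacter ℂ q}

lemma isPrimitive_inv {q : ℕ} {χ : DirichletCharacter ℂ q} (hχ : χ.IsPrimitive) :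
    χ⁻¹.IsPrimitive := by
  rwa [isPrimitive_def, conductor_inv]

lemma gammaFactor_ne_zero_of_re_pos {q : ℕ} (χ : DirichletCharacter ℂ q) {s : ℂ} (hs : 0 < s.re) :
    χ.gammaFactor s ≠ 0 := by
  rcases χ.even_or_odd with h | h
  · rw [h.gammaFactor_def]; exact Gammaℝ_ne_zero_of_re_pos hs
  · rw [h.gammaFactor_def]; exact Gammaℝ_ne_zero_of_re_pos (by simp; linarith)

/-- The symmetry `ρ ↦ 1 - ρ` between the nontrivial zeros of `L(s, χ)` and `L(s, χ⁻¹)`. -/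
lemma isNontrivialZero_inv_one_sub (hχ : χ.IsPrimitive) {w : ℂ} (h : IsNontrivialZero χ w) :
    IsNontrivialZero χ⁻¹ (1 - w) := by
  obtain ⟨h0, h1, hw⟩ := h
  have hw0 : w ≠ 0 := by rintro rfl; simp at h0
  have hw1 : 1 - w ≠ 0 := sub_ne_zero.mpr (by rintro rfl; simp at h1)
  refine ⟨by simpa using h1, by simpa using h0, ?_⟩
  rw [LFunction_eq_completed_div_gammaFactor χ w (.inl hw0), div_eq_zero_iff,
    or_iff_left (gammaFactor_ne_zero_of_re_pos χ h0)] at hw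
  have hfe := (isPrimitive_inv hχ).completedLFunction_one_sub w
  rw [inv_inv, hw, mul_zero] at hfe
  rw [LFunction_eq_completed_div_gammaFactor χ⁻¹ _ (.inl hw1), hfe, zero_div]

lemma conj_LFunction_conj_of_one_lt_re (χ : DirichletCharacter ℂ q) {s : ℂ} (hs : 1 < s.re) :
    conj (χ⁻¹.LFunction (conj s)) = χ.LFunction s := by
  rw [LFunction_eq_LSeries _ (by simpa using hs), LFunction_eq_LSeries _ hs, LSeries, LSeries,
    conj_tsum]
  refine tsum_congr fun n => ?_
  rcases eq_or_ne n 0 with rfl | hn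
  · simp
  rw [LSeries.term_of_ne_zero hn, LSeries.term_of_ne_zero hn, map_div₀, cpow_conj _ _ (by
    rw [natCast_arg]; exact Real.pi_pos.ne), conj_conj, conj_natCast, ← MulChar.star_apply']
  simp

/-- Conjugation transfers zeros of L(s, χ⁻¹) back to L(s, χ). The identity holds termwise for Re s >
1 and extends because both sides are entire. -/
lemma conj_entireL_conj (hχ : χ.IsPrimitive) (s : ℂ) :
    conj (entireL χ⁻¹ (conj s)) = entireL χ s := by
  have h1 : Differentiable ℂ fun s => conj (entireL χ⁻¹ (conj s)) := fun s =>
    by simpa [Function.comp_def] using!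
      (differentiable_entireL (isPrimitive_inv hχ) (conj s)).conj_conj
  have h2 := differentiable_entireL hχ
  refine congrFun (AnalyticOnNhd.eq_of_eventuallyEq (𝕜 := ℂ) (z₀ := 2)
    (h1.differentiableOn.analyticOnNhd isOpen_univ)
    (h2.differentiableOn.analyticOnNhd isOpen_univ) ?_) s
  have : {s : ℂ | 1 < s.re} ∈ 𝓝 (2 : ℂ) :=
    (isOpen_lt continuous_const continuous_re).mem_nhds (by simp)
  filter_upwards [this] with z hz
  have hz1 : z ≠ 1 := by rintro rfl; simp at hz
  have hz2 : conj z ≠ 1 := fun h => hz1 (by rw [← conj_conj z, h, map_one])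
  rw [entireL_eq_mul _ hz1, entireL_eq_mul _ hz2, map_mul, conj_LFunction_conj_of_one_lt_re χ hz]
  congr 1
  unfold poleFactor
  split_ifs <;> simp

/-- The symmetry `ρ ↦ 1 - conj ρ` of the nontrivial zeros of `L(s, χ)`. -/
lemma isNontrivialZero_one_sub_conj (hχ : χ.IsPrimitive) {w : ℂ} (h : IsNontrivialZero χ w) :
    IsNontrivialZero χ (1 - conj w) := by
  obtain ⟨h0, h1, hw⟩ := isNontrivialZero_inv_one_sub hχ h
  have hne : 1 - w ≠ 1 := by intro h; rw [h] at h1; simp at h1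
  have hne' : 1 - conj w ≠ 1 := fun h => hne (by
    have := congrArg conj h; simpa using this)
  refine ⟨by simpa using h0, by simpa using h1, ?_⟩
  have e := conj_entireL_conj hχ (1 - conj w)
  have hc : conj (1 - conj w) = 1 - w := by simp
  rw [hc, entireL_eq_mul _ hne, hw, mul_zero, map_zero, entireL_eq_mul _ hne'] at e
  exact (mul_eq_zero.mp e.symm).resolve_left (poleFactor_ne_zero hne')

lemma entireL_ne_zero_of_generalizedRiemannHypothesis (hχ : χ.IsPrimitive)
    (h : GeneralizedRiemannHypothesis χ) {w : ℂ} (hw : 1 / 2 < w.re) : entireL χ w ≠ 0 := by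
  rcases le_or_gt 1 w.re with h1 | h1
  · exact entireL_ne_zero_of_one_le_re hχ h1
  intro h0
  have hne : w ≠ 1 := by rintro rfl; simp at h1
  rw [entireL_eq_mul χ hne] at h0
  have := h w ⟨by linarith, h1, (mul_eq_zero.mp h0).resolve_left (poleFactor_ne_zero hne)⟩
  linarith

end FunctionalEquation

/-! ### The equivalence. -/

theorem theorem2p2 {q : ℕ} [NeZero q] (χ : DirichletCharacter ℂ q) (hχ : χ.IsPrimitive)
    (k ℓ : ℝ) (hk : 1 ≤ k) (hℓ : 0 < ℓ) :
    (∀ x : ℝ, 0 < x → Tendsto (rieszPartialSum χ k ℓ x) atTop (𝓝 (rieszSum χ k ℓ x))) ∧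
    (GeneralizedRiemannHypothesis χ ↔
      ∀ ε : ℝ, 0 < ε →
        (fun x : ℝ => rieszSum χ k ℓ x) =O[atTop]
          (fun x : ℝ => x ^ (-k / ℓ + 1 / (2 * ℓ) + ε))) := by
  refine ⟨fun x hx => ?_, fun hGRH ε hε => ?_, fun hO => ?_⟩
  · rw [rieszSum_eq hχ hk hℓ hx.le]
    exact tendsto_rieszPartialSum hχ hk hℓ hx.le
  -- The cap keeps a = (k-1/2)/ℓ - δ positive; for larger ε the claim is weaker.
  · set δ : ℝ := min ε ((k - 1 / 2) / (2 * ℓ)) with hδ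
    have hδ0 : 0 < δ := lt_min hε (div_pos (by linarith) (by linarith))
    have hδ1 : δ ≤ ε := min_le_left _ _
    have hδ2 : δ * (2 * ℓ) ≤ k - 1 / 2 :=
      (le_div_iff₀ (by linarith)).mp (min_le_right ε ((k - 1 / 2) / (2 * ℓ)))
    have hℓδ : 0 < ℓ * δ := mul_pos hℓ hδ0
    set a : ℝ := (k - 1 / 2) / ℓ - δ with ha
    have hℓa : ℓ * a = k - 1 / 2 - ℓ * δ := by rw [ha]; field_simp
    have ha0 : 0 < a := by
      by_contra hcon
      nlinarith
    obtain ⟨C, hC⟩ := exists_norm_rieszSum_le_of_ne_zero hχ hk hℓ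
      (fun w hw => entireL_ne_zero_of_generalizedRiemannHypothesis hχ hGRH hw) ha0
      (by rw [hℓa]; linarith)
    have hle : -a ≤ -k / ℓ + 1 / (2 * ℓ) + ε := by
      have : -a = -k / ℓ + 1 / (2 * ℓ) + δ := by rw [ha]; field_simp; ring
      linarith
    refine IsBigO.of_bound |C| ?_
    filter_upwards [eventually_ge_atTop 1] with x hx
    have hx0 : 0 < x := by linarith
    rw [Real.norm_of_nonneg (by positivity)]
    calc ‖rieszSum χ k ℓ x‖ ≤ C * x ^ (-a) := hC x hx0
      _ ≤ |C| * x ^ (-k / ℓ + 1 / (2 * ℓ) + ε) := by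
        gcongr
        exact le_abs_self C
  · have key : ∀ w : ℂ, IsNontrivialZero χ w → w.re ≤ 1 / 2 := by
      rintro w ⟨h0, h1, hw⟩
      by_contra! hlt
      have hne : w ≠ 1 := by rintro rfl; simp at h1
      have hent : entireL χ w = 0 := by rw [entireL_eq_mul χ hne, hw, mul_zero]
      -- With this ε, k-ℓa is the midpoint of 1/2 and Re w, so w lies in the excluded region.
      set ε : ℝ := (w.re - 1 / 2) / (2 * ℓ) with hε
      have hε0 : 0 < ε := div_pos (by linarith) (by linarith)
      set a : ℝ := (k - 1 / 2) / ℓ - ε with ha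
      have hℓε : ℓ * ε = (w.re - 1 / 2) / 2 := by rw [hε]; field_simp
      have hℓa : ℓ * a = k - 1 / 2 - ℓ * ε := by rw [ha]; field_simp
      have ha0 : 0 ≤ a := by
        by_contra hcon
        nlinarith
      have hexp : -k / ℓ + 1 / (2 * ℓ) + ε = -a := by rw [ha]; field_simp; ring
      have hO' := hO ε hε0
      rw [hexp] at hO'
      exact hne (eq_one_of_entireL_eq_zero_of_isBigO hχ hk hℓ ha0 hO'
        (by rw [hℓa, hℓε]; linarith) (by linarith) hent)
    intro w hw
    have h1 := key w hw
    -- The reflected zero has real part 1 - Re w, giving Re w ≥ 1/2.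
    have h2 := key _ (isNontrivialZero_one_sub_conj hχ hw)
    simp only [Complex.sub_re, Complex.one_re, Complex.conj_re] at h2
    linarith
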